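/- Let $A$ be a Polish space with its Borel $\sigma$-field. For a word $\mathbf w=(w_1,\dots,w_n)\in A^n$ and $i\in[n]$ let $\mathrm{erase}(\mathbf w,i)\in A^{n-1}$ be $\mathbf w$ with its $i$-th letter removed. A general erased-word process (GEWP) over $A$ is a stochastic process $(\mathbf W,\boldsymbol\eta)=(\mathbf W_n,\eta_n)_{n\ge1}$ such that for every $n\ge 1$: (i) $\mathbf W_n$ is an $A^n$-valued random variable; (ii) $\eta_n$ is uniform on $[n]$ and independent of $\sigma(\mathbf W_k,\eta_{k+1}:k\ge n)$; (iii) $\mathbf W_n=\mathrm{erase}(\mathbf W_{n+1},\eta_{n+1})$ almost surely. Let $\mathcal M(A)$ be the convex set of all laws of GEWPs over $A$ on $\prod_{n\ge1}(A^n\times[n])$, and let $\mathrm{erg}\,\mathcal M(A)$ (the ergodic laws) be the set of its extreme points. For $\mathbf w\in A^n$ and $k\le n$ put $$\mathrm{RSS}(\mathbf w,k)=\binom nk^{-1}\sum_{1\le j_1<\dots<j_k\le n}\delta_{(w_{j_1},\dots,w_{j_k})}.$$ The Martin boundary $\partial_{\mathrm{RSS}}A$ is the set of all sequences $\boldsymbol\mu=(\mu_k)_{k\ge1}$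 of Borel probability measures $\mu_k$ on $A^k$ for which there is a sequence of finite words $(\mathbf w_m)_{m\ge 1}$ over $A$ with lengths $|\mathbf w_m|\to\infty$ such that, for every $k\ge1$, $\mathrm{RSS}(\mathbf w_m,k)\to\mu_k$ weakly as $m\to\infty$. Let $\mathcal M(\partial_{\mathrm{RSS}}A)$ be the set of all laws of GEWPs $(\mathbf W,\boldsymbol\eta)$ over $A$ for which the sequence of marginal laws $(\mathcal L(\mathbf W_k))_{k\ge1}$ belongs to $\partial_{\mathrm{RSS}}A$. Then $$\mathrm{erg}\,\mathcal M(A)=\mathcal M(\partial_{\mathrm{RSS}}A).$$ Moreover the Martin boundary coincides with the minimal boundary, that is, $$\partial_{\mathrm{RSS}}A=\{(\mathcal L(\mathbf W_k))_{k\ge1}:\ (\mathbf W,\boldsymbol\eta)\text{ is a GEWP over }A\text{ with }\mathcal L(\mathbf W,\boldsymbol\eta)\in\mathrm{erg}\,\mathcal M(A)\}.$$ -/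

import Mathlib

open MeasureTheory ProbabilityTheory Filter Topology
open scoped ENNReal NNReal

universe u

namespace ErasedWord

/-- Words of length `n` over the alphabet `A`. -/
abbrev Word (A : Type u) (n : ℕ) : Type u := Fin n → A

/-- `erase w i` is the word obtained from `w` by erasing its `i`-th letter. -/
def erase {A : Type u} {n : ℕ} (w : Word A (n + 1)) (i : Fin (n + 1)) : Word A n :=
  fun j => w (i.succAbove j)

/-- The backward filtration `σ(W_k, η_{k+1} : k ≥ n)` of a process `(W, η)`. Times are shifted by
one throughout: the index `n : ℕ` stands for time `n + 1 ≥ 1`, at which words have length `n + 1`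
and the eraser takes values in `Fin (n + 1)`. -/
abbrev backwardFiltration {A Ω : Type u} [MeasurableSpace A]
    (W : (n : ℕ) → Ω → Word A (n + 1)) (η : (n : ℕ) → Ω → Fin (n + 1)) (n : ℕ) :
    MeasurableSpace Ω :=
  ⨆ k ≥ n, (MeasurableSpace.comap (W k) inferInstance ⊔
    MeasurableSpace.comap (η (k + 1)) inferInstance)

/-- `(W, η)` is a general erased-word process (GEWP) over `A`, defined on `(Ω, P)`. -/
structure IsGEWP {A Ω : Type u} [MeasurableSpace A] [MeasurableSpace Ω] (P : Measure Ω)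
    (W : (n : ℕ) → Ω → Word A (n + 1)) (η : (n : ℕ) → Ω → Fin (n + 1)) : Prop where
  measurable_word : ∀ n, Measurable (W n)
  measurable_eraser : ∀ n, Measurable (η n)
  uniform_eraser : ∀ n (i : Fin (n + 1)), P (η n ⁻¹' {i}) = ((n + 1 : ℕ) : ℝ≥0∞)⁻¹
  indep_eraser : ∀ n, Indep (MeasurableSpace.comap (η n) inferInstance)
    (backwardFiltration W η n) P
  erase_word : ∀ n, ∀ᵐ ω ∂P, W n ω = erase (W (n + 1) ω) (η (n + 1) ω)

/-- The space of trajectories of a pair (word-process, eraser-process), with the product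
sigma-algebra. -/
abbrev PathSpace (A : Type u) : Type u := (n : ℕ) → Word A (n + 1) × Fin (n + 1)

/-- The set of the laws of all GEWPs over `A`. -/
def gewpLaws (A : Type u) [MeasurableSpace A] : Set (Measure (PathSpace A)) :=
  {Q | ∃ (Ω : Type u) (_ : MeasurableSpace Ω) (P : Measure Ω)
      (W : (n : ℕ) → Ω → Word A (n + 1)) (η : (n : ℕ) → Ω → Fin (n + 1)),
    IsProbabilityMeasure P ∧ IsGEWP P W η ∧ Q = P.map (fun ω n => (W n ω, η n ω))}

/-- The ergodic GEWP laws: the extreme points of the convex set of all GEWP laws. -/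
def ergodicGEWPLaws (A : Type u) [MeasurableSpace A] : Set (Measure (PathSpace A)) :=
  Set.extremePoints ℝ≥0 (gewpLaws A)

/-- `rss w k` is the law of a uniformly chosen subsequence of length `k` of the word `w` of
length `n`: the average, over the `n.choose k` strictly increasing index maps `j`, of the Dirac
measures at `w ∘ j`. It is a probability measure for `k ≤ n` (and the zero measure for `k > n`). -/
noncomputable def rss {A : Type u} [MeasurableSpace A] {n : ℕ} (w : Word A n) (k : ℕ) :
    FiniteMeasure (Word A k) :=
  (n.choose k : ℝ≥0)⁻¹ •
    ∑ j : Fin k ↪o Fin n, (diracProba (fun i => w (j i))).toFiniteMeasure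

/-- The sequence `w` of words has lengths tending to infinity and is RSS-convergent with limit `μ`:
for each `k ≥ 1`, the laws `rss (w m) k` converge weakly as `m → ∞`. The law `μ k` lives on words
of length `k + 1`. -/
def RSSTendsto {A : Type u} [TopologicalSpace A] [PolishSpace A] [MeasurableSpace A] [BorelSpace A]
    (w : ℕ → (n : ℕ) × Word A n) (μ : (k : ℕ) → ProbabilityMeasure (Word A (k + 1))) : Prop :=
  Tendsto (fun m => (w m).1) atTop atTop ∧
    ∀ k, Tendsto (fun m => rss (w m).2 (k + 1)) atTop (𝓝 (μ k).toFiniteMeasure)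

/-- The Martin boundary of the set of all finite words with respect to random subsequences. -/
def martinBoundary (A : Type u) [TopologicalSpace A] [PolishSpace A] [MeasurableSpace A]
    [BorelSpace A] :
    Set ((k : ℕ) → ProbabilityMeasure (Word A (k + 1))) :=
  {μ | ∃ w : ℕ → (n : ℕ) × Word A n, RSSTendsto w μ}

/-- `μ` is the sequence of the laws of the words `W_1, W_2, …` under the law `Q` of `(W, η)`. -/
def HasWordMarginals {A : Type u} [MeasurableSpace A] (Q : Measure (PathSpace A))
    (μ : (k : ℕ) → ProbabilityMeasure (Word A (k + 1))) : Prop :=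
  ∀ k, Q.map (fun x => (x k).1) = (μ k : Measure (Word A (k + 1)))

/-- The GEWP laws whose sequence of word marginals is a point of the Martin boundary. -/
def martinGEWPLaws (A : Type u) [TopologicalSpace A] [PolishSpace A] [MeasurableSpace A]
    [BorelSpace A] :
    Set (Measure (PathSpace A)) :=
  {Q | Q ∈ gewpLaws A ∧ ∃ μ ∈ martinBoundary A, HasWordMarginals Q μ}

/-- The minimal boundary: the sequences of word marginals of ergodic GEWP laws. -/
def minimalBoundary (A : Type u) [MeasurableSpace A] :
    Set ((k : ℕ) → ProbabilityMeasure (Word A (k + 1))) :=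
  {μ | ∃ Q ∈ ergodicGEWPLaws A, HasWordMarginals Q μ}

end ErasedWord

namespace ErasedWord

variable {A : Type u}

section

/-! ### Averages over subwords -/

/-! A GEWP is best read from long words to short ones: given the word at a higher level, a lower
word is a uniformly chosen subword of it (`IsGEWP.integral_mul_eq`). Hence the law is determined by
its word marginals (`eq_of_wordLaw_eq`), and every consistent family of marginals occurs
(`Consistent.exists_gewpLaw`). Both equalities thus become a question about consistent families. For
a bounded `f` on words of a fixed length `k`, let `U_n` be the average of `f` over the `k`-subwords
of the word of length `n`. This is a reverse martingale with constant mean `c`, and the two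
directions both turn on whether `U_n` tends to `c` in `L²`.

Boundary marginals give ergodicity. Erasing one letter of a word of length `N + 1` preserves the
subword average in mean and moves it by `O(1/N)`. Summing squares, the average over random
`n`-subwords of any finite word has variance `O(1/n)`, uniformly in that word (`subwordAvg_sq_le`).
The bound survives weak limits, so `U_n` concentrates at `c` under a boundary family. A component of
positive weight in a convex decomposition inherits the concentration, hence has the same marginals
(`mem_ergodicGEWPLaws_of_martinBoundary`).

Ergodicity gives boundary marginals. The reverse martingale has a bounded limit `h`. Weighting the
process by `1 ± s (h - c)` keeps the word laws consistent and writes the law as a midpoint of two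
GEWP laws; extremality then forces `U_n → c` in `L²` (`tendsto_integral_sub_sq`). Applying this to
countably many `f` that determine weak convergence, one picks deterministic words whose subword laws
converge (`exists_martinBoundary_of_ergodic`). -/

theorem card_orderEmbedding (k n : ℕ) : Fintype.card (Fin k ↪o Fin n) = n.choose k := by
  rw [← Nat.card_eq_fintype_card, Nat.card_congr Set.powersetCard.ofFinEmbEquiv,
    Set.powersetCard.card, Nat.card_fin]

/-- Increasing maps into `Fin n`, composed with `i.succAbove`, are the increasing maps into
`Fin (n + 1)` that avoid `i`. -/
theorem sum_orderEmbedding_succAbove {k n : ℕ} (i : Fin (n + 1)) (F : (Fin k → Fin (n + 1)) → ℝ) :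
    ∑ j : Fin k ↪o Fin n, F (fun a => i.succAbove (j a)) =
      ∑ j : Fin k ↪o Fin (n + 1) with ∀ a, j a ≠ i, F j := by
  refine Finset.sum_bij (fun j _ => j.trans (Fin.succAboveOrderEmb i)) ?_ ?_ ?_ ?_
  · intro j _
    simp
  · intro j _ j' _ h
    refine DFunLike.ext _ _ fun a => ?_
    simpa using DFunLike.congr_fun h a
  · intro j hj
    simp only [Finset.mem_filter, Finset.mem_univ, true_and] at hj
    choose b hb using fun a => Fin.exists_succAbove_eq (hj a)
    refine ⟨OrderEmbedding.ofStrictMono b fun x y hxy => ?_, Finset.mem_univ _, ?_⟩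
    · rw [← (Fin.strictMono_succAbove i).lt_iff_lt, hb, hb]
      exact j.strictMono hxy
    · exact DFunLike.ext _ _ hb
  · intro j _
    rfl

/-- The average of `f` over all subwords of length `k` of the word `w`. -/
noncomputable def subwordAvg (k : ℕ) (f : Word A k → ℝ) {n : ℕ} (w : Word A n) : ℝ :=
  (n.choose k : ℝ)⁻¹ * ∑ j : Fin k ↪o Fin n, f (fun a => w (j a))

/-- The average of `f` over all words that arise from `w` by erasing one letter. -/
noncomputable def eraseAvg {n : ℕ} (f : Word A n → ℝ) (w : Word A (n + 1)) : ℝ :=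
  ((n + 1 : ℕ) : ℝ)⁻¹ * ∑ i, f (erase w i)

theorem choose_mul_subwordAvg {k n : ℕ} (h : k ≤ n) (f : Word A k → ℝ) (w : Word A n) :
    (n.choose k : ℝ) * subwordAvg k f w = ∑ j : Fin k ↪o Fin n, f (fun a => w (j a)) := by
  rw [subwordAvg, mul_inv_cancel_left₀]
  exact_mod_cast (Nat.choose_pos h).ne'

theorem choose_mul_subwordAvg_erase {k n : ℕ} (h : k ≤ n) (f : Word A k → ℝ) (w : Word A (n + 1))
    (i : Fin (n + 1)) :
    (n.choose k : ℝ) * subwordAvg k f (erase w i) =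
      ∑ j : Fin k ↪o Fin (n + 1) with ∀ a, j a ≠ i, f (fun a => w (j a)) := by
  rw [choose_mul_subwordAvg h, ← sum_orderEmbedding_succAbove i (fun j => f fun a => w (j a))]
  rfl

theorem choose_mul_succ_eq_real {k n : ℕ} (h : k ≤ n) :
    (n.choose k : ℝ) * (n + 1) = ((n + 1).choose k : ℝ) * (n + 1 - k) := by
  have := Nat.choose_mul_succ_eq n k
  have h2 : ((n + 1 - k : ℕ) : ℝ) = n + 1 - k := by
    rw [Nat.cast_sub (by omega)]; push_cast; ring
  rw [← h2]
  exact_mod_cast this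

/-- Double counting: each choice of `k` positions survives exactly `n + 1 - k` of the `n + 1`
erasures. -/
theorem eraseAvg_subwordAvg {k n : ℕ} (h : k ≤ n) (f : Word A k → ℝ) (w : Word A (n + 1)) :
    eraseAvg (subwordAvg k f) w = subwordAvg k f w := by
  have hn : (n.choose k : ℝ) ≠ 0 := by exact_mod_cast (Nat.choose_pos h).ne'
  have hn1 : ((n + 1).choose k : ℝ) ≠ 0 := by exact_mod_cast (Nat.choose_pos (by omega)).ne'
  have key : (n.choose k : ℝ) * ∑ i, subwordAvg k f (erase w i) =
      (n + 1 - k) * ∑ j : Fin k ↪o Fin (n + 1), f (fun a => w (j a)) := by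
    rw [Finset.mul_sum]
    simp_rw [choose_mul_subwordAvg_erase h, Finset.sum_filter]
    rw [Finset.sum_comm, Finset.mul_sum]
    refine Finset.sum_congr rfl fun j _ => ?_
    rw [← Finset.sum_filter, Finset.sum_const, nsmul_eq_mul]
    congr 1
    have : (Finset.univ.filter fun i => ∀ a, j a ≠ i) = (Finset.univ.map j.toEmbedding)ᶜ := by
      ext i
      simp
    rw [this, Finset.card_compl, Finset.card_map]
    simp only [Finset.card_univ, Fintype.card_fin]
    rw [Nat.cast_sub (by omega)]
    push_cast
    ring
  rw [← choose_mul_subwordAvg (by omega)] at key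
  have h3 := choose_mul_succ_eq_real h
  rw [eraseAvg]
  push_cast
  rw [inv_mul_eq_iff_eq_mul₀ (by positivity)]
  apply mul_left_cancel₀ hn
  rw [key]
  linear_combination -h3 * subwordAvg k f w

theorem abs_subwordAvg_le {k n : ℕ} {C : ℝ} (hC : 0 ≤ C) {f : Word A k → ℝ} (hf : ∀ v, |f v| ≤ C)
    (w : Word A n) : |subwordAvg k f w| ≤ C := by
  rw [subwordAvg, abs_mul, abs_inv, Nat.abs_cast]
  have : |∑ j : Fin k ↪o Fin n, f (fun a => w (j a))| ≤ (n.choose k : ℝ) * C := by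
    refine (Finset.abs_sum_le_sum_abs _ _).trans ((Finset.sum_le_card_nsmul _ _ C
      fun j _ => hf _).trans ?_)
    rw [Finset.card_univ, card_orderEmbedding, nsmul_eq_mul]
  -- For `k > n` there are no subwords and the average is `0` by convention, whence the need for `0
  -- ≤ C`.
  rcases eq_or_ne (n.choose k : ℝ) 0 with h | h
  · simpa [h]
  · rwa [inv_mul_le_iff₀ (lt_of_le_of_ne (by positivity) h.symm)]

/-- Only the position sets containing `i` matter, and they are a fraction `k / (n + 1)` of all. -/
theorem abs_subwordAvg_erase_sub_le {k n : ℕ} (h : k ≤ n) {C : ℝ} {f : Word A k → ℝ}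
    (hf : ∀ v, |f v| ≤ C) (w : Word A (n + 1)) (i : Fin (n + 1)) :
    |subwordAvg k f (erase w i) - subwordAvg k f w| ≤ 2 * k * C / (n + 1) := by
  have hC : 0 ≤ C := (abs_nonneg _).trans (hf (fun a => w ⟨a, by omega⟩))
  have hn1 : 0 < ((n + 1).choose k : ℝ) := by exact_mod_cast Nat.choose_pos (by omega)
  have e1 := choose_mul_subwordAvg (show k ≤ n + 1 by omega) f w
  have e2 := choose_mul_subwordAvg_erase h f w i
  have e3 := choose_mul_succ_eq_real h
  have split := Finset.sum_filter_add_sum_filter_not (Finset.univ : Finset (Fin k ↪o Fin (n + 1)))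
    (fun j => ∀ a, j a ≠ i) (fun j => f (fun a => w (j a)))
  have card : (((Finset.univ : Finset (Fin k ↪o Fin (n + 1))).filter
      (fun j => ¬ ∀ a, j a ≠ i)).card : ℝ) = (n + 1).choose k - n.choose k := by
    have s1 := Finset.sum_filter_add_sum_filter_not
      (Finset.univ : Finset (Fin k ↪o Fin (n + 1))) (fun j => ∀ a, j a ≠ i) (fun _ => (1 : ℝ))
    have s2 := sum_orderEmbedding_succAbove (k := k) i (fun _ => (1 : ℝ))
    rw [← s2] at s1
    simp only [Finset.sum_const, Finset.card_univ, card_orderEmbedding, nsmul_eq_mul,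
      mul_one] at s1
    linarith
  set R := ∑ j : Fin k ↪o Fin (n + 1) with ¬ ∀ a, j a ≠ i, f (fun a => w (j a)) with hR
  have bR : |R| ≤ ((n + 1).choose k - n.choose k) * C := by
    rw [← card, ← nsmul_eq_mul]
    exact (Finset.abs_sum_le_sum_abs _ _).trans (Finset.sum_le_card_nsmul _ _ C fun j _ => hf _)
  have bU := abs_subwordAvg_le hC hf (erase w i)
  set x := subwordAvg k f (erase w i)
  set y := subwordAvg k f w
  rw [← e2, ← e1] at split
  have eq : ((n + 1).choose k : ℝ) * (x - y) = ((n + 1).choose k - n.choose k) * x - R := by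
    linarith
  have hd : (((n + 1).choose k : ℝ) - n.choose k) * (n + 1) = (n + 1).choose k * k := by
    linarith
  have hd0 : 0 ≤ ((n + 1).choose k : ℝ) - n.choose k := by
    rw [← card]; positivity
  have b : ((n + 1).choose k : ℝ) * |x - y| ≤ ((n + 1).choose k - n.choose k) * (2 * C) := by
    rw [← abs_of_pos hn1, ← abs_mul, abs_of_pos hn1, eq]
    refine (abs_sub _ _).trans ?_
    rw [abs_mul, abs_of_nonneg hd0]
    nlinarith
  rw [le_div_iff₀ (by positivity)]
  refine le_of_mul_le_mul_left ?_ hn1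
  calc ((n + 1).choose k : ℝ) * (|x - y| * (n + 1))
      = (n + 1).choose k * |x - y| * (n + 1) := by ring
    _ ≤ ((n + 1).choose k - n.choose k) * (2 * C) * (n + 1) := by gcongr
    _ = (n + 1).choose k * (2 * k * C) := by linear_combination 2 * C * hd

theorem eraseAvg_mono {n : ℕ} {f g : Word A n → ℝ} (h : ∀ v, f v ≤ g v) (w : Word A (n + 1)) :
    eraseAvg f w ≤ eraseAvg g w := by
  unfold eraseAvg
  gcongr
  exact h _

theorem eraseAvg_add_const {n : ℕ} (f : Word A n → ℝ) (c : ℝ) (w : Word A (n + 1)) :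
    eraseAvg (fun v => f v + c) w = eraseAvg f w + c := by
  simp only [eraseAvg, Finset.sum_add_distrib, Finset.sum_const, Finset.card_univ,
    Fintype.card_fin, nsmul_eq_mul]
  rw [mul_add, inv_mul_cancel_left₀ (by positivity)]

/-- The variance under one random erasure is at most the square of the largest deviation from the
mean. -/
theorem eraseAvg_sq_le {k n : ℕ} (h : k ≤ n) {C : ℝ} {f : Word A k → ℝ} (hf : ∀ v, |f v| ≤ C)
    (w : Word A (n + 1)) :
    eraseAvg (fun v => subwordAvg k f v ^ 2) w ≤
      subwordAvg k f w ^ 2 + (2 * k * C / (n + 1)) ^ 2 := by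
  have hm := eraseAvg_subwordAvg h f w
  set y := subwordAvg k f w
  have hC : 0 ≤ C := (abs_nonneg _).trans (hf (fun a => w ⟨a, by omega⟩))
  -- This is `(x - y) ^ 2 ≤ d ^ 2` expanded; the term linear in `x` averages to `2 * y ^ 2`.
  have hb : ∀ i, subwordAvg k f (erase w i) ^ 2 ≤
      (2 * k * C / (n + 1)) ^ 2 + 2 * y * subwordAvg k f (erase w i) - y ^ 2 := by
    intro i
    have := sq_le_sq' (by linarith [neg_abs_le (subwordAvg k f (erase w i) - y),
      abs_subwordAvg_erase_sub_le h hf w i])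
      ((le_abs_self _).trans (abs_subwordAvg_erase_sub_le h hf w i))
    nlinarith
  have hp : (0 : ℝ) < ((n + 1 : ℕ) : ℝ) := by positivity
  unfold eraseAvg at hm ⊢
  rw [inv_mul_eq_iff_eq_mul₀ hp.ne'] at hm
  rw [inv_mul_le_iff₀ hp]
  refine (Finset.sum_le_sum fun i _ => hb i).trans (le_of_eq ?_)
  rw [Finset.sum_sub_distrib, Finset.sum_add_distrib, ← Finset.mul_sum, hm]
  simp only [Finset.sum_const, Finset.card_univ, Fintype.card_fin, nsmul_eq_mul]
  ring

theorem subwordAvg_self {n : ℕ} (f : Word A n → ℝ) (w : Word A n) : subwordAvg n f w = f w := by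
  have hc : Fintype.card (Fin n ↪o Fin n) = 1 := by simp [card_orderEmbedding]
  obtain ⟨j, hj⟩ := Fintype.card_eq_one_iff.1 hc
  have : (Finset.univ : Finset (Fin n ↪o Fin n)) = {RelEmbedding.refl _} := by
    ext x
    simp [hj x, hj (RelEmbedding.refl _)]
  simp [subwordAvg, this]

/-- Sampling is transitive: a random subword of a random subword is a random subword. -/
theorem subwordAvg_subwordAvg {k n N : ℕ} (hk : k ≤ n) (hn : n ≤ N) (f : Word A k → ℝ)
    (w : Word A N) : subwordAvg n (subwordAvg k f) w = subwordAvg k f w := by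
  induction N, hn using Nat.le_induction with
  | base => exact subwordAvg_self _ _
  | succ N hN ih =>
    rw [← eraseAvg_subwordAvg hN, ← eraseAvg_subwordAvg (hk.trans hN)]
    exact congrArg (eraseAvg · w) (funext fun v => ih v)

theorem subwordAvg_eraseAvg {n N : ℕ} (hn : n + 1 ≤ N) (f : Word A n → ℝ) (w : Word A N) :
    subwordAvg (n + 1) (eraseAvg f) w = subwordAvg n f w := by
  rw [← subwordAvg_subwordAvg n.le_succ hn]
  congr 1
  funext v
  rw [← eraseAvg_subwordAvg le_rfl]
  simp only [eraseAvg, subwordAvg_self]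

/-- One-step variances of order `1 / N ^ 2` add up to `O(1 / n)`. That the error does not involve
`N` is what allows the passage to the limit along words of growing length. -/
theorem subwordAvg_sq_le {k n N : ℕ} (hk : k ≤ n) (hn0 : 0 < n) (hn : n ≤ N) {C : ℝ}
    {f : Word A k → ℝ} (hf : ∀ v, |f v| ≤ C) (w : Word A N) :
    subwordAvg n (fun v => subwordAvg k f v ^ 2) w ≤
      subwordAvg k f w ^ 2 + (2 * k * C) ^ 2 / n := by
  -- The sharper error `1 / n - 1 / N` telescopes, so induction on `N` closes.
  suffices h : subwordAvg n (fun v => subwordAvg k f v ^ 2) w ≤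
      subwordAvg k f w ^ 2 + (2 * k * C) ^ 2 * (1 / n - 1 / N) by
    refine h.trans ?_
    have : (0 : ℝ) ≤ (2 * k * C) ^ 2 * (1 / N) := by positivity
    rw [div_eq_mul_one_div (_ ^ 2)]
    linarith
  induction N, hn using Nat.le_induction with
  | base => simp [subwordAvg_self]
  | succ N hN ih =>
    rw [← eraseAvg_subwordAvg hN]
    refine (eraseAvg_mono ih w).trans ?_
    rw [eraseAvg_add_const]
    have h1 := eraseAvg_sq_le (hk.trans hN) hf w
    have hN0 : (0 : ℝ) < N := by exact_mod_cast (by omega : 0 < N)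
    have h2 : (1 : ℝ) / (N + 1) ^ 2 ≤ 1 / N - 1 / (N + 1) := by
      rw [div_sub_div _ _ hN0.ne' (by positivity), div_le_div_iff₀ (by positivity) (by positivity)]
      nlinarith
    have h3 := mul_le_mul_of_nonneg_left h2 (sq_nonneg (2 * k * C))
    have h4 : (2 * k * C / (N + 1)) ^ 2 = (2 * k * C) ^ 2 * (1 / (N + 1) ^ 2) := by
      rw [div_pow, div_eq_mul_one_div]
    push_cast
    linarith

end

section

/-! ### Words and erasers below a given level -/

/-- The average of `g` over the trajectories that agree with `x₀` above level `n`, that have the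
word `w` at level `n`, and whose erasers up to level `n` are independent and uniform. -/
noncomputable def towerAvg (x₀ : PathSpace A) :
    (n : ℕ) → (PathSpace A → ℝ≥0∞) → Word A (n + 1) → ℝ≥0∞
  | 0, g, w => g (Function.update x₀ 0 (w, 0))
  | n + 1, g, w => ((n + 1 + 1 : ℕ) : ℝ≥0∞)⁻¹ *
      ∑ i, towerAvg x₀ n (fun x => g (Function.update x (n + 1) (w, i))) (erase w i)

/-- The average only evaluates its integrand at trajectories with the prescribed top part and word.
-/
theorem towerAvg_congr {x₀ : PathSpace A} {n : ℕ} {g g' : PathSpace A → ℝ≥0∞} {w : Word A (n + 1)}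
    (h : ∀ x, (∀ k > n, x k = x₀ k) → (x n).1 = w → g x = g' x) :
    towerAvg x₀ n g w = towerAvg x₀ n g' w := by
  induction n generalizing g g' with
  | zero =>
    refine h _ (fun k hk => ?_) ?_
    · rw [Function.update_of_ne (by omega)]
    · rw [Function.update_self]
  | succ n ih =>
    simp only [towerAvg]
    congr 1
    refine Finset.sum_congr rfl fun i _ => ih fun x hx _ => h _ (fun k hk => ?_) ?_
    · rw [Function.update_of_ne (by omega), hx k (by omega)]
    · rw [Function.update_self]

theorem towerAvg_const (x₀ : PathSpace A) (n : ℕ) (c : ℝ≥0∞) (w : Word A (n + 1)) :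
    towerAvg x₀ n (fun _ => c) w = c := by
  induction n with
  | zero => rfl
  | succ n ih =>
    simp only [towerAvg, ih, Finset.sum_const, Finset.card_univ, Fintype.card_fin, nsmul_eq_mul]
    rw [← mul_assoc, ENNReal.inv_mul_cancel (by simp) (by finiteness), one_mul]

variable [MeasurableSpace A]

@[fun_prop]
theorem measurable_erase {n : ℕ} (i : Fin (n + 1)) : Measurable fun w : Word A (n + 1) => erase w i :=
  measurable_pi_lambda _ fun _ => measurable_pi_apply _

theorem measurable_update_path {E : Type*} [MeasurableSpace E] {n : ℕ} {a : E → PathSpace A}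
    {b : E → Word A (n + 1) × Fin (n + 1)} (ha : Measurable a) (hb : Measurable b) :
    Measurable fun e => Function.update (a e) n (b e) :=
  (measurable_update' (a := n)).comp (ha.prodMk hb)

/-- The parameter space `E` is there for the induction: descending one level turns the current word
into a parameter. -/
theorem measurable_towerAvg (x₀ : PathSpace A) (n : ℕ) {E : Type u} [MeasurableSpace E]
    {g : E × PathSpace A → ℝ≥0∞} (hg : Measurable g) :
    Measurable fun p : E × Word A (n + 1) => towerAvg x₀ n (fun x => g (p.1, x)) p.2 := by
  induction n generalizing E with
  | zero =>
    simp only [towerAvg]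
    refine hg.comp (measurable_fst.prodMk ((measurable_update x₀).comp ?_))
    exact measurable_snd.prodMk measurable_const
  | succ n ih =>
    simp only [towerAvg]
    refine measurable_const.mul (Finset.measurable_sum _ fun i _ => ?_)
    have h1 : Measurable fun q : (E × Word A (n + 1 + 1)) × PathSpace A =>
        g (q.1.1, Function.update q.2 (n + 1) (q.1.2, i)) := by
      refine hg.comp ((measurable_fst.comp measurable_fst).prodMk
        (measurable_update_path measurable_snd ?_))
      exact (measurable_snd.comp measurable_fst).prodMk measurable_const
    have h2 : Measurable fun p : E × Word A (n + 1 + 1) => (p, erase p.2 i) :=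
      measurable_id.prodMk ((measurable_erase i).comp measurable_snd)
    exact (ih h1).comp h2

theorem measurable_towerAvg_right (x₀ : PathSpace A) (n : ℕ) {g : PathSpace A → ℝ≥0∞}
    (hg : Measurable g) : Measurable (towerAvg x₀ n g) :=
  (measurable_towerAvg x₀ n (E := PUnit) (g := fun p => g p.2) (hg.comp measurable_snd)).comp
    (measurable_const (a := PUnit.unit) |>.prodMk measurable_id)

/-- The words `W_1, W_2, …` of a trajectory with law `Q` have the laws `μ`, and given `W_n` the
erasers up to level `n` are independent and uniform, and they produce the earlier words. -/
def IsTowerLaw (x₀ : PathSpace A) (Q : Measure (PathSpace A))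
    (μ : (n : ℕ) → Measure (Word A (n + 1))) : Prop :=
  ∀ n (g : PathSpace A → ℝ≥0∞), Measurable g → DependsOn g (Set.Iic n) →
    ∫⁻ x, g x ∂Q = ∫⁻ w, towerAvg x₀ n g w ∂μ n

/-- Measures on trajectories that agree on sets determined by finitely many coordinates. -/
theorem ext_of_dependsOn {Q Q' : Measure (PathSpace A)} [IsFiniteMeasure Q]
    (h : ∀ n (g : PathSpace A → ℝ≥0∞), Measurable g → DependsOn g (Set.Iic n) →
      ∫⁻ x, g x ∂Q = ∫⁻ x, g x ∂Q') : Q = Q' := by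
  have hQ : IsProjectiveLimit Q' (fun I : Finset ℕ => Q.map I.restrict) := by
    intro I
    ext S hS
    have hm : Measurable (I.restrict : PathSpace A → _) := by fun_prop
    rw [Measure.map_apply hm hS, Measure.map_apply hm hS, ← lintegral_indicator_one (hm hS),
      ← lintegral_indicator_one (hm hS)]
    -- A finite set of coordinates lies below its supremum, so cylinder events are covered.
    refine (h (I.sup id) _ (measurable_one.indicator (hm hS)) ?_).symm
    intro x y hxy
    have : I.restrict x = I.restrict y :=
      funext fun i => hxy i (Finset.le_sup (f := id) i.2)
    change S.indicator (fun _ => (1 : ℝ≥0∞)) (I.restrict x) = S.indicator (fun _ => 1) (I.restrict y)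
    rw [this]
  exact IsProjectiveLimit.unique (P := fun I : Finset ℕ => Q.map I.restrict) (fun I => rfl) hQ

theorem IsTowerLaw.map_word {x₀ : PathSpace A} {Q : Measure (PathSpace A)}
    {μ : (n : ℕ) → Measure (Word A (n + 1))} (h : IsTowerLaw x₀ Q μ) (n : ℕ) :
    Q.map (fun x => (x n).1) = μ n := by
  have hm : Measurable fun x : PathSpace A => (x n).1 := by fun_prop
  ext S hS
  rw [Measure.map_apply hm hS, ← lintegral_indicator_one (hm hS), ← lintegral_indicator_one hS,
    h n _ (measurable_one.indicator (hm hS))]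
  · refine lintegral_congr fun w => ?_
    rw [← towerAvg_const x₀ n (S.indicator 1 w) w]
    refine towerAvg_congr fun x _ hx => ?_
    change S.indicator 1 (x n).1 = _
    rw [hx]
  · intro x y hxy
    change S.indicator (fun _ => (1 : ℝ≥0∞)) (x n).1 = S.indicator (fun _ => 1) (y n).1
    rw [hxy n (Set.mem_Iic.2 le_rfl)]

/-! ### Laws of general erased-word processes -/

section Gewp

variable {Ω E : Type u} [MeasurableSpace Ω] [MeasurableSpace E] {P : Measure Ω}
  {W : (n : ℕ) → Ω → Word A (n + 1)} {η : (n : ℕ) → Ω → Fin (n + 1)}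

omit [MeasurableSpace Ω] in
theorem backwardFiltration_antitone : Antitone (backwardFiltration W η) := by
  intro m n hmn
  exact iSup₂_le fun k hk => le_iSup₂_of_le k (hmn.trans hk) le_rfl

omit [MeasurableSpace Ω] in
theorem measurable_word_backwardFiltration {n k : ℕ} (h : n ≤ k) :
    Measurable[backwardFiltration W η n] (W k) := by
  rw [measurable_iff_comap_le]
  exact le_iSup₂_of_le k h le_sup_left

omit [MeasurableSpace Ω] in
theorem measurable_eraser_backwardFiltration (n : ℕ) :
    Measurable[backwardFiltration W η n] (η (n + 1)) := by
  rw [measurable_iff_comap_le]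
  exact le_iSup₂_of_le n le_rfl le_sup_right

namespace IsGEWP

theorem backwardFiltration_le (h : IsGEWP P W η) (n : ℕ) :
    backwardFiltration W η n ≤ ‹MeasurableSpace Ω› :=
  iSup₂_le fun k _ => sup_le (h.measurable_word k).comap_le (h.measurable_eraser _).comap_le

theorem measurable_path (h : IsGEWP P W η) :
    Measurable fun ω n => (W n ω, η n ω) :=
  measurable_pi_lambda _ fun n => (h.measurable_word n).prodMk (h.measurable_eraser n)

/-- The eraser at level `n` is uniform and independent of everything above it. -/
theorem map_eraser_prodMk (h : IsGEWP P W η) (n : ℕ) {Y : Ω → E}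
    (hY : Measurable[backwardFiltration W η n] Y) :
    P.map (fun ω => (η n ω, Y ω)) =
      ((n + 1 : ℕ) : ℝ≥0∞)⁻¹ • ∑ i, P.map (fun ω => (i, Y ω)) := by
  have hYm : Measurable Y := hY.mono (h.backwardFiltration_le n) le_rfl
  have hη := h.measurable_eraser n
  ext S hS
  rw [Measure.map_apply (hη.prodMk hYm) hS, Measure.smul_apply, Measure.finsetSum_apply,
    smul_eq_mul, Finset.mul_sum]
  have hS' : ∀ i, MeasurableSet {e : E | (i, e) ∈ S} := fun i =>
    (measurable_const.prodMk measurable_id) hS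
  have hu : (fun ω => (η n ω, Y ω)) ⁻¹' S =
      ⋃ i, (η n ⁻¹' {i} ∩ Y ⁻¹' {e | (i, e) ∈ S}) := by
    ext ω
    simp
  rw [hu, measure_iUnion, tsum_fintype]
  · refine Finset.sum_congr rfl fun i _ => ?_
    rw [Measure.map_apply (measurable_const.prodMk hYm) hS]
    have := (Indep_iff _ _ _).1 (h.indep_eraser n) (η n ⁻¹' {i}) (Y ⁻¹' {e | (i, e) ∈ S})
      ⟨{i}, measurableSet_singleton i, rfl⟩ (hY (hS' i))
    rw [this, h.uniform_eraser]
    rfl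
  · intro i j hij
    refine Set.disjoint_left.2 fun ω hi hj => hij ?_
    simp only [Set.mem_inter_iff, Set.mem_preimage, Set.mem_singleton_iff] at hi hj
    exact hi.1.symm.trans hj.1
  · exact fun i => (hη (measurableSet_singleton i)).inter (hYm (hS' i))

/-- Successively integrate out the erasers, from the lowest level upwards. The variable `Z` stores
the levels above the one being treated, from which the current eraser is independent. -/
theorem lintegral_path (h : IsGEWP P W η) (x₀ : PathSpace A) (n : ℕ) {Z : Ω → E}
    (hZ : Measurable[backwardFiltration W η n] Z) {g : E × PathSpace A → ℝ≥0∞}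
    (hg : Measurable g) (hd : ∀ e, DependsOn (fun x => g (e, x)) (Set.Iic n)) :
    ∫⁻ ω, g (Z ω, fun k => (W k ω, η k ω)) ∂P =
      ∫⁻ ω, towerAvg x₀ n (fun x => g (Z ω, x)) (W n ω) ∂P := by
  induction n generalizing E with
  | zero =>
    refine lintegral_congr fun ω => hd _ fun k hk => ?_
    obtain rfl : k = 0 := by simpa using hk
    simp only [Function.update_self]
    exact Prod.ext rfl (Subsingleton.elim (α := Fin 1) _ _)
  | succ n ih =>
    have hZ' : Measurable[backwardFiltration W η n] Z :=
      hZ.mono (backwardFiltration_antitone n.le_succ) le_rfl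
    have hW' : Measurable[backwardFiltration W η n] (W (n + 1)) :=
      measurable_word_backwardFiltration n.le_succ
    -- Level `n + 1` moves into the parameter so that the induction hypothesis handles the levels
    -- below it.
    let Z' : Ω → E × (Word A (n + 1 + 1) × Fin (n + 1 + 1)) := fun ω => (Z ω, W (n + 1) ω, η (n + 1) ω)
    let g' : (E × (Word A (n + 1 + 1) × Fin (n + 1 + 1))) × PathSpace A → ℝ≥0∞ :=
      fun p => g (p.1.1, Function.update p.2 (n + 1) p.1.2)
    have hg' : Measurable g' := by
      exact hg.comp ((measurable_fst.comp measurable_fst).prodMk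
        (measurable_update_path measurable_snd (measurable_snd.comp measurable_fst)))
    have hd' : ∀ e, DependsOn (fun x => g' (e, x)) (Set.Iic n) := by
      intro e x y hxy
      refine hd e.1 fun k hk => ?_
      rcases eq_or_ne k (n + 1) with rfl | hk'
      · simp
      · rw [Function.update_of_ne hk', Function.update_of_ne hk']
        exact hxy k (Set.mem_Iic.2 (by have := Set.mem_Iic.1 hk; omega))
    have hH : Measurable fun q : Fin (n + 1 + 1) × (E × Word A (n + 1 + 1)) =>
        towerAvg x₀ n (fun x => g (q.2.1, Function.update x (n + 1) (q.2.2, q.1)))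
          (erase q.2.2 q.1) := by
      refine measurable_from_prod_countable_right fun i => ?_
      have h1 : Measurable fun q : (E × Word A (n + 1 + 1)) × PathSpace A =>
          g (q.1.1, Function.update q.2 (n + 1) (q.1.2, i)) := by
        refine hg.comp ((measurable_fst.comp measurable_fst).prodMk
          (measurable_update_path measurable_snd ?_))
        exact (measurable_snd.comp measurable_fst).prodMk measurable_const
      have h2 : Measurable fun p : E × Word A (n + 1 + 1) => (p, erase p.2 i) :=
        measurable_id.prodMk ((measurable_erase i).comp measurable_snd)
      exact (measurable_towerAvg x₀ n h1).comp h2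
    have hY : Measurable[backwardFiltration W η (n + 1)] fun ω => (Z ω, W (n + 1) ω) :=
      hZ.prodMk (measurable_word_backwardFiltration le_rfl)
    have hYm := hY.mono (h.backwardFiltration_le _) le_rfl
    calc ∫⁻ ω, g (Z ω, fun k => (W k ω, η k ω)) ∂P
        = ∫⁻ ω, g' (Z' ω, fun k => (W k ω, η k ω)) ∂P := by
          refine lintegral_congr fun ω => ?_
          simp only [g', Z']
          rw [Function.update_eq_self (n + 1) (fun k => (W k ω, η k ω))]
      _ = ∫⁻ ω, towerAvg x₀ n (fun x => g' (Z' ω, x)) (W n ω) ∂P :=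
          ih (hZ'.prodMk (hW'.prodMk (measurable_eraser_backwardFiltration n))) hg' hd'
      _ = ∫⁻ ω, towerAvg x₀ n (fun x => g' (Z' ω, x)) (erase (W (n + 1) ω) (η (n + 1) ω)) ∂P := by
          refine lintegral_congr_ae ?_
          filter_upwards [h.erase_word n] with ω hω
          rw [hω]
      _ = ∫⁻ q, towerAvg x₀ n (fun x => g (q.2.1, Function.update x (n + 1) (q.2.2, q.1)))
          (erase q.2.2 q.1) ∂(P.map fun ω => (η (n + 1) ω, (Z ω, W (n + 1) ω))) := by
          rw [lintegral_map hH ((h.measurable_eraser _).prodMk hYm)]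
      _ = ∫⁻ ω, towerAvg x₀ (n + 1) (fun x => g (Z ω, x)) (W (n + 1) ω) ∂P := by
          rw [h.map_eraser_prodMk (n + 1) hY, lintegral_smul_measure, lintegral_finsetSum_measure]
          simp only [towerAvg]
          rw [lintegral_const_mul, lintegral_finsetSum, smul_eq_mul]
          · congr 1
            refine Finset.sum_congr rfl fun i _ => ?_
            rw [lintegral_map hH (measurable_const.prodMk hYm)]
          · exact fun i _ => hH.comp (measurable_const.prodMk hYm)
          · exact Finset.measurable_sum _ fun i _ => hH.comp (measurable_const.prodMk hYm)

theorem isTowerLaw (h : IsGEWP P W η) (x₀ : PathSpace A) :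
    IsTowerLaw x₀ (P.map fun ω n => (W n ω, η n ω)) (fun n => P.map (W n)) := by
  intro n g hg hd
  rw [lintegral_map hg h.measurable_path,
    lintegral_map (measurable_towerAvg_right x₀ n hg) (h.measurable_word n)]
  exact h.lintegral_path x₀ n (E := PUnit) (Z := fun _ => PUnit.unit) measurable_const
    (g := fun p => g p.2) (hg.comp measurable_snd) fun _ => hd

/-- Given everything above level `n`, the word at level `n` is obtained from the one at level
`n + 1` by erasing a uniformly chosen letter. -/
theorem map_word_prodMk (h : IsGEWP P W η) (n : ℕ) {Y : Ω → E}
    (hY : Measurable[backwardFiltration W η (n + 1)] Y) :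
    P.map (fun ω => (W n ω, Y ω)) =
      ((n + 1 + 1 : ℕ) : ℝ≥0∞)⁻¹ • ∑ i, P.map (fun ω => (erase (W (n + 1) ω) i, Y ω)) := by
  have hYm : Measurable Y := hY.mono (h.backwardFiltration_le _) le_rfl
  have hW := h.measurable_word (n + 1)
  have hφ : Measurable fun q : Fin (n + 1 + 1) × (Word A (n + 1 + 1) × E) =>
      (erase q.2.1 q.1, q.2.2) :=
    measurable_from_prod_countable_right fun i =>
      ((measurable_erase i).comp measurable_fst).prodMk measurable_snd
  have h1 := congrArg (Measure.map fun q => (erase q.2.1 q.1, q.2.2))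
    (h.map_eraser_prodMk (n + 1) (Y := fun ω => (W (n + 1) ω, Y ω))
      ((measurable_word_backwardFiltration le_rfl).prodMk hY))
  rw [Measure.map_map hφ ((h.measurable_eraser _).prodMk (hW.prodMk hYm)), Measure.map_smul,
    Measure.map_finset_sum] at h1
  · rw [Measure.map_congr (g := fun ω => (erase (W (n + 1) ω) (η (n + 1) ω), Y ω))]
    · refine h1.trans ?_
      congr 1
      refine Finset.sum_congr rfl fun i _ => ?_
      rw [Measure.map_map hφ (measurable_const.prodMk (hW.prodMk hYm))]
      rfl
    · filter_upwards [h.erase_word n] with ω hω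
      rw [hω]
  · exact hφ.aemeasurable

end IsGEWP

end Gewp

end

section

open Preorder in
theorem map_eval_zero_trajMeasure {X : ℕ → Type*} [∀ n, MeasurableSpace (X n)]
    (ν : Measure (X 0)) [IsProbabilityMeasure ν]
    (κ : (n : ℕ) → Kernel ((i : Finset.Iic n) → X i) (X (n + 1))) [∀ n, IsMarkovKernel (κ n)] :
    (Kernel.trajMeasure ν κ).map (fun x => x 0) = ν := by
  let e : ((i : Finset.Iic 0) → X i) → X 0 := fun p => p ⟨0, Finset.mem_Iic.2 le_rfl⟩
  have he : Measurable e :=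
    measurable_pi_apply (X := fun i : Finset.Iic 0 => X i) ⟨0, Finset.mem_Iic.2 le_rfl⟩
  have h1 : (Kernel.trajMeasure ν κ).map (fun x => x 0) =
      ((Kernel.trajMeasure ν κ).map (frestrictLe 0)).map e := by
    rw [Measure.map_map he (measurable_frestrictLe 0)]
    rfl
  rw [h1, Kernel.trajMeasure, Measure.map_comp _ _ (measurable_frestrictLe 0),
    Kernel.traj_map_frestrictLe, Kernel.partialTraj_self, Measure.id_comp]
  exact (Measure.map_map (μ := ν) he (MeasurableEquiv.measurable
    (MeasurableEquiv.piUnique (fun i : Finset.Iic 0 => X i)).symm)).trans Measure.map_id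

/-! ### Existence of processes with given word marginals -/

/-- The eraser at level `n` is uniform, whatever happens above it. -/
theorem towerAvg_ite_eraser (x₀ : PathSpace A) {n m : ℕ} (hnm : n ≤ m) (I : Finset (Fin (n + 1)))
    {h : PathSpace A → ℝ≥0∞}
    (hh : ∀ x y, (∀ k > n, x k = y k) → (x n).1 = (y n).1 → h x = h y) (w : Word A (m + 1)) :
    towerAvg x₀ m (fun x => if (x n).2 ∈ I then h x else 0) w =
      (I.card * ((n + 1 : ℕ) : ℝ≥0∞)⁻¹) * towerAvg x₀ m h w := by
  induction m, hnm using Nat.le_induction generalizing h with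
  | base =>
    -- Level `0` is separate: its only eraser is fixed in `towerAvg`, so `I` is empty or everything.
    cases n with
    | zero =>
      by_cases h0 : (0 : Fin 1) ∈ I
      · have : I = {0} := by
          ext i
          simp [Subsingleton.elim (α := Fin 1) i 0, h0]
        simp [towerAvg, this]
      · have : I = ∅ := by
          ext i
          simp [Subsingleton.elim (α := Fin 1) i 0, h0]
        simp [towerAvg, this]
    | succ n =>
      have hc : ∀ x i, (∀ k > n, x k = x₀ k) → h (Function.update x (n + 1) (w, i)) =
          h (Function.update x₀ (n + 1) (w, 0)) := fun x i hx => hh _ _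
        (fun k hk => by
          rw [Function.update_of_ne (by omega), Function.update_of_ne (by omega), hx k (by omega)])
        (by rw [Function.update_self, Function.update_self])
      have hv : ∀ i w', towerAvg x₀ n (fun x =>
          if (Function.update x (n + 1) (w, i) (n + 1)).2 ∈ I
            then h (Function.update x (n + 1) (w, i)) else 0) w' =
          if i ∈ I then h (Function.update x₀ (n + 1) (w, 0)) else 0 := fun i w' =>
        (towerAvg_congr fun x hx _ => by rw [Function.update_self, hc x i hx]).trans
          (towerAvg_const _ _ _ _)
      have hv' : towerAvg x₀ (n + 1) h w = h (Function.update x₀ (n + 1) (w, 0)) := by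
        rw [← towerAvg_const x₀ (n + 1) (h (Function.update x₀ (n + 1) (w, 0))) w]
        refine towerAvg_congr fun x hx hxw => hh _ _ (fun k hk => ?_) ?_
        · rw [Function.update_of_ne (by omega), hx k hk]
        · rw [Function.update_self, hxw]
      rw [hv', towerAvg]
      simp only [hv]
      rw [← Finset.sum_filter, Finset.sum_const, Finset.filter_univ_mem, nsmul_eq_mul]
      ring
  | succ m hm ih =>
    have hne : n ≠ m + 1 := by omega
    simp only [towerAvg, Function.update_of_ne hne]
    conv_rhs => rw [mul_left_comm, Finset.mul_sum]
    congr 1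
    refine Finset.sum_congr rfl fun i _ => ih (fun x y hxy hxy' => hh _ _ (fun k hk => ?_) ?_) _
    · rcases eq_or_ne k (m + 1) with rfl | hk'
      · simp
      · rw [Function.update_of_ne hk', Function.update_of_ne hk', hxy k hk]
    · rw [Function.update_of_ne hne, Function.update_of_ne hne, hxy']

variable [MeasurableSpace A]

/-- A family of laws of words in which each law is obtained from the next one by erasing a
uniformly chosen letter. -/
def Consistent (μ : (n : ℕ) → Measure (Word A (n + 1))) : Prop :=
  ∀ n, μ n = ((n + 1 + 1 : ℕ) : ℝ≥0∞)⁻¹ • ∑ i, (μ (n + 1)).map fun w => erase w i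

theorem lintegral_towerAvg (x₀ : PathSpace A) (n : ℕ) {E : Type u} [MeasurableSpace E]
    {g : E × PathSpace A → ℝ≥0∞} (hg : Measurable g) (ν : Measure E) (w : Word A (n + 1)) :
    ∫⁻ e, towerAvg x₀ n (fun x => g (e, x)) w ∂ν =
      towerAvg x₀ n (fun x => ∫⁻ e, g (e, x) ∂ν) w := by
  induction n generalizing g with
  | zero => rfl
  | succ n ih =>
    have h1 : ∀ i, Measurable fun q : E × PathSpace A =>
        g (q.1, Function.update q.2 (n + 1) (w, i)) := fun i =>
      hg.comp (measurable_fst.prodMk (measurable_update_path measurable_snd measurable_const))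
    have h2 : ∀ i, Measurable fun e =>
        towerAvg x₀ n (fun x => g (e, Function.update x (n + 1) (w, i))) (erase w i) := fun i =>
      (measurable_towerAvg x₀ n (h1 i)).comp (measurable_id.prodMk measurable_const)
    simp only [towerAvg]
    rw [lintegral_const_mul _ (Finset.measurable_sum _ fun i _ => h2 i),
      lintegral_finsetSum _ fun i _ => h2 i]
    congr 1
    exact Finset.sum_congr rfl fun i _ => ih (h1 i) _

section Existence

variable (μ : (n : ℕ) → Measure (Word A (n + 1)))

/-- The joint law of `(W_n, (W_{n+1}, η_{n+1}))` for words with the laws `μ`. -/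
noncomputable def stepLaw (n : ℕ) :
    Measure (Word A (n + 1) × (Word A (n + 1 + 1) × Fin (n + 1 + 1))) :=
  ((n + 1 + 1 : ℕ) : ℝ≥0∞)⁻¹ • ∑ i, (μ (n + 1)).map fun w => (erase w i, (w, i))

instance isFiniteMeasure_stepLaw [∀ n, IsProbabilityMeasure (μ n)] (n : ℕ) :
    IsFiniteMeasure (stepLaw μ n) := by
  unfold stepLaw
  have : IsFiniteMeasure (∑ i, (μ (n + 1)).map fun w => (erase w i, (w, i))) := inferInstance
  exact Measure.smul_finite _ (by simp)

variable {μ}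

theorem measurable_erase_prodMk {n : ℕ} (i : Fin (n + 1 + 1)) :
    Measurable fun w : Word A (n + 1 + 1) => (erase w i, (w, i)) := by
  fun_prop

theorem Consistent.fst_stepLaw (h : Consistent μ) (n : ℕ) : (stepLaw μ n).fst = μ n := by
  rw [Measure.fst, stepLaw, Measure.map_smul, Measure.map_finset_sum, h n]
  · congr 1
    refine Finset.sum_congr rfl fun i _ => ?_
    rw [Measure.map_map measurable_fst (measurable_erase_prodMk i)]
    rfl
  · exact measurable_fst.aemeasurable

theorem lintegral_stepLaw (n : ℕ) {Φ : Word A (n + 1) × (Word A (n + 1 + 1) × Fin (n + 1 + 1)) → ℝ≥0∞}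
    (hΦ : Measurable Φ) : ∫⁻ q, Φ q ∂stepLaw μ n =
      ∫⁻ w, ((n + 1 + 1 : ℕ) : ℝ≥0∞)⁻¹ * ∑ i, Φ (erase w i, (w, i)) ∂μ (n + 1) := by
  rw [stepLaw, lintegral_smul_measure, lintegral_finsetSum_measure, lintegral_const_mul,
    lintegral_finsetSum, smul_eq_mul]
  · congr 1
    refine Finset.sum_congr rfl fun i _ => ?_
    rw [lintegral_map hΦ (measurable_erase_prodMk i)]
  · exact fun i _ => hΦ.comp (measurable_erase_prodMk i)
  · exact Finset.measurable_sum _ fun i _ => hΦ.comp (measurable_erase_prodMk i)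

open Preorder in
-- The dynamics are given downwards but there is no top level to start from, so the chain is built
-- upwards: disintegrate each one-step law over the shorter word and apply Ionescu-Tulcea.
-- Consistency makes the successive steps fit together.
theorem exists_isTowerLaw [StandardBorelSpace A] [Nonempty A]
    [∀ n, IsProbabilityMeasure (μ n)] (h : Consistent μ) (x₀ : PathSpace A) :
    ∃ Q : Measure (PathSpace A), IsProbabilityMeasure Q ∧ IsTowerLaw x₀ Q μ := by
  have hm : ∀ n : ℕ, Measurable fun x : (i : Finset.Iic n) → Word A ((i : ℕ) + 1) × Fin ((i : ℕ) + 1) =>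
      (x ⟨n, Finset.mem_Iic.2 le_rfl⟩).1 := fun n => by
    have := measurable_pi_apply (X := fun i : Finset.Iic n =>
      Word A ((i : ℕ) + 1) × Fin ((i : ℕ) + 1)) ⟨n, Finset.mem_Iic.2 le_rfl⟩
    exact measurable_fst.comp this
  -- The next pair depends on the past only through the current word.
  let κ : (n : ℕ) → Kernel ((i : Finset.Iic n) → Word A ((i : ℕ) + 1) × Fin ((i : ℕ) + 1))
      (Word A (n + 1 + 1) × Fin (n + 1 + 1)) := fun n => (stepLaw μ n).condKernel.comap _ (hm n)
  have : ∀ n, IsMarkovKernel (κ n) := fun n => by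
    dsimp only [κ]; infer_instance
  let ν : Measure (Word A (0 + 1) × Fin (0 + 1)) := (μ 0).map fun w => (w, 0)
  have : IsProbabilityMeasure ν := Measure.isProbabilityMeasure_map (by fun_prop)
  let Q : Measure (PathSpace A) :=
    Kernel.trajMeasure (X := fun n => Word A (n + 1) × Fin (n + 1)) ν κ
  have hQ : IsProbabilityMeasure Q := by dsimp only [Q]; infer_instance
  refine ⟨Q, hQ, fun n => ?_⟩
  induction n with
  | zero =>
    intro g hg hd
    have hQ0 : Q.map (fun x => x 0) = ν := map_eval_zero_trajMeasure _ _
    have hg' : Measurable fun y => g (Function.update x₀ 0 y) :=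
      hg.comp (measurable_update x₀)
    calc ∫⁻ x, g x ∂Q = ∫⁻ x, g (Function.update x₀ 0 (x 0)) ∂Q := by
          refine lintegral_congr fun x => hd fun k hk => ?_
          obtain rfl : k = 0 := by simpa using hk
          simp
      _ = ∫⁻ y, g (Function.update x₀ 0 y) ∂ν := by
          rw [← hQ0, lintegral_map hg' (measurable_pi_apply 0)]
      _ = ∫⁻ w, towerAvg x₀ 0 g w ∂μ 0 := by
          rw [lintegral_map hg' (by fun_prop)]
          rfl
  | succ n ih =>
    intro g hg hd
    -- The coordinates above `n` are filled from `x₀`; this is harmless because `g` sees only levels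
    -- up to `n + 1`.
    let ext : ((i : Finset.Iic n) → Word A ((i : ℕ) + 1) × Fin ((i : ℕ) + 1)) → PathSpace A :=
      fun p k => if hk : k ≤ n then p ⟨k, Finset.mem_Iic.2 hk⟩ else x₀ k
    have hext : Measurable ext := by
      refine measurable_pi_lambda _ fun k => ?_
      by_cases hk : k ≤ n
      · simp only [ext, hk, dite_true]
        exact measurable_pi_apply _
      · simp only [ext, hk, dite_false]
        exact measurable_const
    have hext_apply : ∀ x y, g (Function.update (ext (frestrictLe n x)) (n + 1) y) =
        g (Function.update x (n + 1) y) := by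
      intro x y
      refine hd fun k hk => ?_
      rcases eq_or_ne k (n + 1) with rfl | hk'
      · simp
      · have : k ≤ n := by have := Set.mem_Iic.1 hk; omega
        simp [Function.update_of_ne hk', ext, this]
    let G : ((i : Finset.Iic n) → Word A ((i : ℕ) + 1) × Fin ((i : ℕ) + 1)) ×
        (Word A (n + 1 + 1) × Fin (n + 1 + 1)) → ℝ≥0∞ :=
      fun q => g (Function.update (ext q.1) (n + 1) q.2)
    have hG : Measurable G :=
      hg.comp (measurable_update_path (hext.comp measurable_fst) measurable_snd)
    let H : PathSpace A → ℝ≥0∞ := fun x => ∫⁻ y, G (frestrictLe n x, y) ∂κ n (frestrictLe n x)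
    have hH : Measurable H :=
      (Measurable.lintegral_kernel_prod_right' (κ := κ n) hG).comp (measurable_frestrictLe n)
    have hHd : DependsOn H (Set.Iic n) := by
      intro x y hxy
      have : frestrictLe n x = frestrictLe n y :=
        funext fun i => hxy i (Finset.mem_Iic.1 i.2)
      simp only [H, this]
    have hΦ : Measurable fun q : Word A (n + 1) × (Word A (n + 1 + 1) × Fin (n + 1 + 1)) =>
        towerAvg x₀ n (fun x => g (Function.update x (n + 1) q.2)) q.1 := by
      have h1 : Measurable fun q : (Word A (n + 1 + 1) × Fin (n + 1 + 1)) × PathSpace A =>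
          g (Function.update q.2 (n + 1) q.1) :=
        hg.comp (measurable_update_path measurable_snd measurable_fst)
      exact (measurable_towerAvg x₀ n h1).comp measurable_swap
    calc ∫⁻ x, g x ∂Q = ∫⁻ x, G (frestrictLe n x, x (n + 1)) ∂Q := by
          refine lintegral_congr fun x => ?_
          simp only [G]
          rw [hext_apply, Function.update_eq_self]
      _ = ∫⁻ x, H x ∂Q := by
          rw [← lintegral_map (f := G) (g := fun x : PathSpace A => (frestrictLe n x, x (n + 1)))
            hG ((measurable_frestrictLe n).prodMk (measurable_pi_apply _)),
            ← Kernel.map_frestrictLe_trajMeasure_compProd_eq_map_trajMeasure,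
            Measure.lintegral_compProd hG, lintegral_map _ (measurable_frestrictLe n)]
          exact Measurable.lintegral_kernel_prod_right' (κ := κ n) hG
      _ = ∫⁻ v, towerAvg x₀ n H v ∂μ n := ih H hH hHd
      _ = ∫⁻ v, ∫⁻ y, towerAvg x₀ n (fun x => g (Function.update x (n + 1) y)) v
            ∂(stepLaw μ n).condKernel v ∂μ n := by
          refine lintegral_congr fun v => ?_
          rw [lintegral_towerAvg x₀ n (g := fun q => g (Function.update q.2 (n + 1) q.1))
            (hg.comp (measurable_update_path measurable_snd measurable_fst))]
          refine towerAvg_congr fun x _ hx => ?_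
          have : κ n (frestrictLe n x) = (stepLaw μ n).condKernel v := by
            simp only [κ, Kernel.comap_apply, frestrictLe_apply, hx]
          simp only [H, G, this]
          exact lintegral_congr fun y => hext_apply _ _
      _ = ∫⁻ q, towerAvg x₀ n (fun x => g (Function.update x (n + 1) q.2)) q.1 ∂stepLaw μ n := by
          conv_rhs => rw [← (stepLaw μ n).disintegrate (stepLaw μ n).condKernel, h.fst_stepLaw]
          rw [Measure.lintegral_compProd hΦ]
      _ = ∫⁻ w, towerAvg x₀ (n + 1) g w ∂μ (n + 1) := lintegral_stepLaw n hΦ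

end Existence

/-- A tower law is the law of a general erased-word process. -/
theorem IsTowerLaw.mem_gewpLaws [StandardBorelSpace A] {x₀ : PathSpace A}
    {μ : (n : ℕ) → Measure (Word A (n + 1))} {Q : Measure (PathSpace A)} [IsProbabilityMeasure Q]
    (h : IsTowerLaw x₀ Q μ) : Q ∈ gewpLaws A := by
  let W : (n : ℕ) → PathSpace A → Word A (n + 1) := fun n x => (x n).1
  let η : (n : ℕ) → PathSpace A → Fin (n + 1) := fun n x => (x n).2
  have hW : ∀ n, Measurable (W n) := fun n => (measurable_pi_apply n).fst
  have hη : ∀ n, Measurable (η n) := fun n => (measurable_pi_apply n).snd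
  -- This keeps the levels from `n` to `m + 1` and forgets the eraser at level `n`, whose
  -- independence is at stake; the bound is `m + 1` because `G n m` contains the eraser one level
  -- above `m`.
  let φ : (n m : ℕ) → PathSpace A → PathSpace A := fun n m x k =>
    if k < n ∨ m + 1 < k then x₀ k else ((x k).1, if k = n then 0 else (x k).2)
  have hφ : ∀ n m, Measurable (φ n m) := by
    intro n m
    refine measurable_pi_lambda _ fun k => ?_
    by_cases hk : k < n ∨ m + 1 < k
    · simp only [φ, hk, if_true]
      exact measurable_const
    · simp only [φ, hk, if_false]
      by_cases hkn : k = n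
      · simp only [hkn, if_true]
        exact (hW k).prodMk measurable_const
      · simp only [hkn, if_false]
        exact (hW k).prodMk (hη k)
  let G : (n m : ℕ) → MeasurableSpace (PathSpace A) := fun n m =>
    ⨆ k ∈ Set.Icc n m, (MeasurableSpace.comap (W k) inferInstance ⊔
      MeasurableSpace.comap (η (k + 1)) inferInstance)
  have hGφ : ∀ n m, G n m ≤ MeasurableSpace.comap (φ n m) inferInstance := by
    intro n m
    refine iSup₂_le fun k hk => sup_le ?_ ?_
    · have : W k = W k ∘ φ n m := by
        funext x
        have : ¬ (k < n ∨ m + 1 < k) := by have := hk.1; have := hk.2; omega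
        simp [W, φ, this]
      rw [this, ← MeasurableSpace.comap_comp]
      exact MeasurableSpace.comap_mono (hW k).comap_le
    · have : η (k + 1) = η (k + 1) ∘ φ n m := by
        funext x
        have h1 : ¬ (k + 1 < n ∨ m + 1 < k + 1) := by have := hk.1; have := hk.2; omega
        have h2 : k + 1 ≠ n := by have := hk.1; omega
        simp only [η, φ, Function.comp_apply, h1, h2, if_false]
      rw [this, ← MeasurableSpace.comap_comp]
      exact MeasurableSpace.comap_mono (hη (k + 1)).comap_le
  have key : ∀ n m, n ≤ m → ∀ (I : Finset (Fin (n + 1))) (S : Set (PathSpace A)),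
      MeasurableSet[G n m] S →
        Q (η n ⁻¹' I ∩ S) = (I.card * ((n + 1 : ℕ) : ℝ≥0∞)⁻¹) * Q S := by
    intro n m hnm I S hS
    obtain ⟨T, hT, rfl⟩ := hGφ n m S hS
    have hφT := hφ n m hT
    have hI : MeasurableSet (η n ⁻¹' (I : Set (Fin (n + 1)))) := hη n (Set.toFinite _).measurableSet
    have hd : ∀ x y : PathSpace A, (∀ k > n, k ≤ m + 1 → x k = y k) → (x n).1 = (y n).1 →
        φ n m x = φ n m y := by
      intro x y hxy hn
      funext k
      by_cases hk : k < n ∨ m + 1 < k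
      · simp only [φ, hk, if_true]
      · simp only [φ, hk, if_false]
        rcases eq_or_ne k n with rfl | hkn
        · simp [hn]
        · rw [hxy k (by omega) (by omega)]
    have h1 : (η n ⁻¹' (I : Set (Fin (n + 1))) ∩ φ n m ⁻¹' T).indicator (1 : PathSpace A → ℝ≥0∞) =
        fun x => if (x n).2 ∈ I then (φ n m ⁻¹' T).indicator 1 x else 0 := by
      funext x
      by_cases hx : (x n).2 ∈ I
      · rw [if_pos hx]
        by_cases hx' : x ∈ φ n m ⁻¹' T
        · rw [Set.indicator_of_mem hx',
            Set.indicator_of_mem (show x ∈ η n ⁻¹' (I : Set _) ∩ φ n m ⁻¹' T from ⟨hx, hx'⟩)]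
        · rw [Set.indicator_of_notMem hx', Set.indicator_of_notMem fun h => hx' h.2]
      · rw [if_neg hx, Set.indicator_of_notMem fun h => hx h.1]
    have hdI : ∀ x y : PathSpace A, φ n m x = φ n m y →
        (φ n m ⁻¹' T).indicator (1 : PathSpace A → ℝ≥0∞) x = (φ n m ⁻¹' T).indicator 1 y := by
      intro x y hxy
      change T.indicator (fun _ => (1 : ℝ≥0∞)) (φ n m x) = T.indicator (fun _ => 1) (φ n m y)
      rw [hxy]
    rw [← lintegral_indicator_one hφT, ← lintegral_indicator_one (hI.inter hφT),
      h (m + 1) _ (measurable_one.indicator hφT),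
      h (m + 1) _ (measurable_one.indicator (hI.inter hφT)), ← lintegral_const_mul, h1]
    · refine lintegral_congr fun w => ?_
      exact towerAvg_ite_eraser x₀ (by omega) I
        (fun x y hxy hn => hdI x y (hd x y (fun k hk _ => hxy k hk) hn)) w
    · exact measurable_towerAvg_right x₀ _ (measurable_one.indicator hφT)
    · rw [h1]
      intro x y hxy
      simp only [hxy n (Set.mem_Iic.2 (by omega))]
      rw [hdI x y (hd x y (fun k _ hk => hxy k hk) (by rw [hxy n (Set.mem_Iic.2 (by omega))]))]
    · intro x y hxy
      exact hdI x y (hd x y (fun k _ hk => hxy k hk) (by rw [hxy n (Set.mem_Iic.2 (by omega))]))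
  refine ⟨PathSpace A, inferInstance, Q, W, η, inferInstance, ⟨hW, hη, ?_, ?_, ?_⟩, ?_⟩
  · intro n i
    have := key n n le_rfl {i} Set.univ MeasurableSet.univ
    simpa using this
  · intro n
    have hsup : backwardFiltration W η n = ⨆ m, G n (n + m) := by
      refine le_antisymm (iSup₂_le fun k hk => ?_) (iSup_le fun m => iSup₂_le fun k hk => ?_)
      · exact le_iSup_of_le (k - n) (le_iSup₂_of_le k ⟨hk, by omega⟩ le_rfl)
      · exact le_iSup₂_of_le k hk.1 le_rfl
    have hle : ∀ m, G n m ≤ (inferInstance : MeasurableSpace (PathSpace A)) := fun m =>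
      iSup₂_le fun k _ => sup_le (hW k).comap_le (hη _).comap_le
    rw [hsup]
    -- The finite windows increase to the backward filtration, so independence from each window
    -- suffices.
    refine (indep_iSup_of_monotone (fun m => ?_) (fun m => hle _) (hη n).comap_le ?_).symm
    · rw [Indep_iff]
      rintro S _ hS ⟨I, -, rfl⟩
      have hI : I = ((Set.toFinite I).toFinset : Set (Fin (n + 1))) := by simp
      rw [Set.inter_comm, hI, key n (n + m) (by omega) _ S hS]
      have := key n n le_rfl (Set.toFinite I).toFinset Set.univ MeasurableSet.univ
      rw [Set.inter_univ, measure_univ, mul_one] at this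
      rw [this, mul_comm]
    · intro a b hab
      exact iSup₂_le fun k hk =>
        le_iSup₂_of_le k ⟨hk.1, hk.2.trans (Nat.add_le_add_left hab n)⟩ le_rfl
  · intro n
    have hms : MeasurableSet {x : PathSpace A | W n x = erase (W (n + 1) x) (η (n + 1) x)} := by
      refine measurableSet_eq_fun (hW n) ?_
      exact (measurable_from_prod_countable_right (f := fun q : Fin (n + 1 + 1) × Word A (n + 1 + 1) =>
        erase q.2 q.1) fun i => measurable_erase i).comp ((hη (n + 1)).prodMk (hW (n + 1)))
    rw [ae_iff]
    change Q {x | W n x = erase (W (n + 1) x) (η (n + 1) x)}ᶜ = 0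
    rw [← lintegral_indicator_one hms.compl, h (n + 1) _ (measurable_one.indicator hms.compl)]
    · refine (lintegral_congr fun w => ?_).trans lintegral_zero
      have : ∀ i : Fin (n + 1 + 1), towerAvg x₀ n (fun x =>
          {x | W n x = erase (W (n + 1) x) (η (n + 1) x)}ᶜ.indicator (1 : PathSpace A → ℝ≥0∞)
            (Function.update x (n + 1) (w, i))) (erase w i) = 0 := by
        intro i
        rw [← towerAvg_const x₀ n 0 (erase w i)]
        refine towerAvg_congr fun x _ hx => ?_
        simp [W, η, hx]
      simp only [towerAvg, this]
      simp
    · intro x y hxy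
      have h1 := hxy n (Set.mem_Iic.2 (by omega))
      have h2 := hxy (n + 1) (Set.mem_Iic.2 le_rfl)
      have hiff : x ∈ {x | W n x = erase (W (n + 1) x) (η (n + 1) x)}ᶜ ↔
          y ∈ {x | W n x = erase (W (n + 1) x) (η (n + 1) x)}ᶜ := by
        change ¬ (x n).1 = erase (x (n + 1)).1 (x (n + 1)).2 ↔
          ¬ (y n).1 = erase (y (n + 1)).1 (y (n + 1)).2
        rw [h1, h2]
      by_cases hx : x ∈ {x | W n x = erase (W (n + 1) x) (η (n + 1) x)}ᶜ
      · rw [Set.indicator_of_mem hx, Set.indicator_of_mem (hiff.1 hx)]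
        rfl
      · rw [Set.indicator_of_notMem hx, Set.indicator_of_notMem fun h => hx (hiff.2 h)]
  · exact Measure.map_id.symm

end

section

/-! ### Integrals of subword averages -/

theorem integrable_sub_sq {Ω : Type*} [MeasurableSpace Ω] {P : Measure Ω} [IsFiniteMeasure P]
    {g : Ω → ℝ} (hg : Integrable g P) (hg2 : Integrable (fun ω => g ω ^ 2) P) (c : ℝ) :
    Integrable (fun ω => (g ω - c) ^ 2) P := by
  simp only [sub_sq]
  exact (hg2.sub ((hg.const_mul 2).mul_const c)).add (integrable_const _)

theorem integral_sub_sq {Ω : Type*} [MeasurableSpace Ω] {P : Measure Ω} [IsProbabilityMeasure P]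
    {g : Ω → ℝ} (hg : Integrable g P) (hg2 : Integrable (fun ω => g ω ^ 2) P) (c : ℝ) :
    ∫ ω, (g ω - c) ^ 2 ∂P = ∫ ω, g ω ^ 2 ∂P - 2 * c * ∫ ω, g ω ∂P + c ^ 2 := by
  have hexp : ∀ ω, (g ω - c) ^ 2 = g ω ^ 2 - 2 * c * g ω + c ^ 2 := fun ω => by ring
  have hi : Integrable (fun ω => 2 * c * g ω) P := hg.const_mul _
  have hi' : Integrable (fun ω => g ω ^ 2 - 2 * c * g ω) P := hg2.sub hi
  simp only [hexp]
  rw [integral_add hi' (integrable_const _), integral_sub hg2 hi, integral_const_mul,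
    integral_const]
  simp

theorem sq_integral_le {Ω : Type*} [MeasurableSpace Ω] {P : Measure Ω} [IsProbabilityMeasure P]
    {g : Ω → ℝ} (hg : Integrable g P) (hg2 : Integrable (fun ω => g ω ^ 2) P) :
    (∫ ω, g ω ∂P) ^ 2 ≤ ∫ ω, g ω ^ 2 ∂P := by
  have h0 : 0 ≤ ∫ ω, (g ω - ∫ ω, g ω ∂P) ^ 2 ∂P := integral_nonneg fun ω => sq_nonneg _
  rw [integral_sub_sq hg hg2] at h0
  linarith

theorem integrable_of_abs_le {Ω : Type*} [MeasurableSpace Ω] {P : Measure Ω} [IsFiniteMeasure P]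
    {g : Ω → ℝ} (hg : Measurable g) {C : ℝ} (hC : ∀ ω, |g ω| ≤ C) : Integrable g P :=
  Integrable.of_bound hg.aestronglyMeasurable C (Eventually.of_forall hC)

theorem abs_eraseAvg_le {n : ℕ} {f : Word A n → ℝ} {C : ℝ} (hC : ∀ v, |f v| ≤ C)
    (w : Word A (n + 1)) : |eraseAvg f w| ≤ C := by
  rw [eraseAvg, abs_mul, abs_inv, Nat.abs_cast, inv_mul_le_iff₀ (by positivity)]
  refine (Finset.abs_sum_le_sum_abs _ _).trans
    ((Finset.sum_le_card_nsmul _ _ C fun j _ => hC _).trans ?_)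
  rw [Finset.card_univ, nsmul_eq_mul, Fintype.card_fin]

section Measurable

variable [MeasurableSpace A]

@[fun_prop]
theorem measurable_subwordAvg (k : ℕ) {n : ℕ} {f : Word A k → ℝ} (hf : Measurable f) :
    Measurable (subwordAvg k f : Word A n → ℝ) := by
  unfold subwordAvg
  refine measurable_const.mul (Finset.measurable_sum _ fun j _ => hf.comp ?_)
  exact measurable_pi_lambda _ fun a => measurable_pi_apply _

variable {μ : (n : ℕ) → Measure (Word A (n + 1))}

theorem integral_smul_sum_map {Ω E : Type*} [MeasurableSpace Ω] [MeasurableSpace E] {P : Measure Ω}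
    [IsFiniteMeasure P] {n : ℕ} {φ : Fin (n + 1) → Ω → E} (hφ : ∀ i, Measurable (φ i)) {f : E → ℝ}
    (hf : Measurable f) {C : ℝ} (hC : ∀ v, |f v| ≤ C) :
    ∫ v, f v ∂(((n + 1 : ℕ) : ℝ≥0∞)⁻¹ • ∑ i, P.map (φ i)) =
      ∫ ω, ((n + 1 : ℕ) : ℝ)⁻¹ * ∑ i, f (φ i ω) ∂P := by
  rw [integral_smul_measure, integral_finsetSum_measure fun i _ => integrable_of_abs_le hf hC,
    integral_const_mul, integral_finsetSum]
  rotate_left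
  · exact fun i _ => integrable_of_abs_le (hf.comp (hφ i)) fun ω => hC _
  simp only [ENNReal.toReal_inv, ENNReal.toReal_natCast, smul_eq_mul]
  congr 1
  exact Finset.sum_congr rfl fun i _ => integral_map (hφ i).aemeasurable hf.aestronglyMeasurable

theorem Consistent.integral_eraseAvg [∀ n, IsProbabilityMeasure (μ n)] (h : Consistent μ) (n : ℕ)
    {f : Word A (n + 1) → ℝ} (hf : Measurable f) {C : ℝ} (hC : ∀ v, |f v| ≤ C) :
    ∫ v, f v ∂μ n = ∫ w, eraseAvg f w ∂μ (n + 1) := by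
  rw [h n, integral_smul_sum_map (fun i => measurable_erase i) hf hC]
  rfl

theorem Consistent.integral_subwordAvg [∀ n, IsProbabilityMeasure (μ n)] (h : Consistent μ)
    {k n : ℕ} (hkn : k ≤ n) {f : Word A (k + 1) → ℝ} (hf : Measurable f) {C : ℝ}
    (hC : ∀ v, |f v| ≤ C) : ∫ v, f v ∂μ k = ∫ w, subwordAvg (k + 1) f w ∂μ n := by
  induction n, hkn using Nat.le_induction with
  | base => simp only [subwordAvg_self]
  | succ n hn ih =>
    have hC0 : 0 ≤ C := by
      obtain ⟨w⟩ := nonempty_of_isProbabilityMeasure (μ k)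
      exact (abs_nonneg _).trans (hC w)
    rw [ih, h.integral_eraseAvg n (measurable_subwordAvg _ hf) (abs_subwordAvg_le hC0 hC)]
    simp only [eraseAvg_subwordAvg (Nat.succ_le_succ hn)]

theorem IsGEWP.consistent {Ω : Type u} [MeasurableSpace Ω] {P : Measure Ω}
    {W : (n : ℕ) → Ω → Word A (n + 1)} {η : (n : ℕ) → Ω → Fin (n + 1)} (h : IsGEWP P W η) :
    Consistent fun n => P.map (W n) := by
  intro n
  have h1 := congrArg (Measure.map Prod.fst)
    (h.map_word_prodMk n (Y := fun _ => PUnit.unit.{u + 1}) measurable_const)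
  rw [Measure.map_map measurable_fst ((h.measurable_word n).prodMk measurable_const),
    Measure.map_smul, Measure.map_finset_sum measurable_fst.aemeasurable] at h1
  refine h1.trans ?_
  congr 1
  refine Finset.sum_congr rfl fun i _ => ?_
  have he : Measurable fun ω => erase (W (n + 1) ω) i :=
    (measurable_erase i).comp (h.measurable_word (n + 1))
  rw [Measure.map_map measurable_fst (he.prodMk measurable_const),
    Measure.map_map (measurable_erase i) (h.measurable_word (n + 1))]
  rfl

/-- The laws of the words under the law `Q` of a trajectory. -/
noncomputable def wordLaw (Q : Measure (PathSpace A)) (n : ℕ) : Measure (Word A (n + 1)) :=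
  Q.map fun x => (x n).1

theorem measurable_pathWord (n : ℕ) : Measurable fun x : PathSpace A => (x n).1 :=
  (measurable_pi_apply n).fst

instance isProbabilityMeasure_wordLaw (Q : Measure (PathSpace A)) [IsProbabilityMeasure Q] (n : ℕ) :
    IsProbabilityMeasure (wordLaw Q n) :=
  Measure.isProbabilityMeasure_map (measurable_pathWord n).aemeasurable

theorem wordLaw_map {Ω : Type u} [MeasurableSpace Ω] {P : Measure Ω}
    {W : (n : ℕ) → Ω → Word A (n + 1)} {η : (n : ℕ) → Ω → Fin (n + 1)} (h : IsGEWP P W η) :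
    wordLaw (P.map fun ω n => (W n ω, η n ω)) = fun n => P.map (W n) := by
  funext n
  rw [wordLaw, Measure.map_map (measurable_pathWord n) h.measurable_path]
  rfl

variable {Q Q' : Measure (PathSpace A)}

theorem isProbabilityMeasure_of_mem_gewpLaws (h : Q ∈ gewpLaws A) : IsProbabilityMeasure Q := by
  obtain ⟨Ω, _, P, W, η, hP, h, rfl⟩ := h
  exact Measure.isProbabilityMeasure_map h.measurable_path.aemeasurable

theorem consistent_wordLaw (h : Q ∈ gewpLaws A) : Consistent (wordLaw Q) := by
  obtain ⟨Ω, _, P, W, η, hP, h, rfl⟩ := h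
  rw [wordLaw_map h]
  exact h.consistent

theorem isTowerLaw_wordLaw (h : Q ∈ gewpLaws A) (x₀ : PathSpace A) :
    IsTowerLaw x₀ Q (wordLaw Q) := by
  obtain ⟨Ω, _, P, W, η, hP, h, rfl⟩ := h
  rw [wordLaw_map h]
  exact h.isTowerLaw x₀

/-- The law of a general erased-word process is determined by the laws of its words. -/
theorem eq_of_wordLaw_eq (h : Q ∈ gewpLaws A) (h' : Q' ∈ gewpLaws A)
    (hw : ∀ n, wordLaw Q n = wordLaw Q' n) : Q = Q' := by
  have := isProbabilityMeasure_of_mem_gewpLaws h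
  obtain ⟨x₀⟩ := nonempty_of_isProbabilityMeasure Q
  refine ext_of_dependsOn fun n g hg hd => ?_
  rw [isTowerLaw_wordLaw h x₀ n g hg hd, isTowerLaw_wordLaw h' x₀ n g hg hd, hw]

/-- The tower formula is linear in the word law, so convex combinations can be checked on marginals.
-/
theorem eq_smul_add_smul_of_wordLaw_eq {Q₁ Q₂ : Measure (PathSpace A)} (h : Q ∈ gewpLaws A)
    (h₁ : Q₁ ∈ gewpLaws A) (h₂ : Q₂ ∈ gewpLaws A) {a b : ℝ≥0}
    (hw : ∀ n, wordLaw Q n = a • wordLaw Q₁ n + b • wordLaw Q₂ n) : Q = a • Q₁ + b • Q₂ := by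
  have := isProbabilityMeasure_of_mem_gewpLaws h
  obtain ⟨x₀⟩ := nonempty_of_isProbabilityMeasure Q
  refine ext_of_dependsOn fun n g hg hd => ?_
  rw [isTowerLaw_wordLaw h x₀ n g hg hd, lintegral_add_measure, lintegral_smul_measure,
    lintegral_smul_measure, isTowerLaw_wordLaw h₁ x₀ n g hg hd,
    isTowerLaw_wordLaw h₂ x₀ n g hg hd, hw, lintegral_add_measure, lintegral_smul_measure,
    lintegral_smul_measure]

/-- Consistent laws are the laws of the words of a general erased-word process. -/
theorem Consistent.exists_gewpLaw [StandardBorelSpace A] [∀ n, IsProbabilityMeasure (μ n)]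
    (h : Consistent μ) : ∃ Q ∈ gewpLaws A, ∀ n, wordLaw Q n = μ n := by
  obtain ⟨w⟩ := nonempty_of_isProbabilityMeasure (μ 0)
  have : Nonempty A := ⟨w 0⟩
  obtain ⟨Q, hQ, hT⟩ := exists_isTowerLaw h (fun n => (fun _ => w 0, 0))
  exact ⟨Q, hT.mem_gewpLaws, hT.map_word⟩

end Measurable

/-! ### Martin boundary points -/

section Boundary

variable [TopologicalSpace A]

@[fun_prop]
theorem continuous_subwordAvg (k : ℕ) {n : ℕ} {f : Word A k → ℝ} (hf : Continuous f) :
    Continuous (subwordAvg k f : Word A n → ℝ) := by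
  unfold subwordAvg
  refine continuous_const.mul (continuous_finsetSum _ fun j _ => hf.comp ?_)
  exact continuous_pi fun a => continuous_apply _

theorem bcf_abs_le {X : Type*} [TopologicalSpace X] (f : BoundedContinuousFunction X ℝ) (x : X) :
    |f x| ≤ ‖f‖ := f.norm_coe_le_norm x

theorem continuous_erase {n : ℕ} (i : Fin (n + 1)) : Continuous fun w : Word A (n + 1) => erase w i :=
  continuous_pi fun _ => continuous_apply _

variable [PolishSpace A] [MeasurableSpace A] [BorelSpace A]

theorem integral_rss {n : ℕ} (w : Word A n) (k : ℕ) (f : Word A k → ℝ) :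
    ∫ v, f v ∂(rss w k : Measure (Word A k)) = subwordAvg k f w := by
  have h : (rss w k : Measure (Word A k)) = (n.choose k : ℝ≥0)⁻¹ •
      ∑ j : Fin k ↪o Fin n, Measure.dirac (fun i => w (j i)) := by
    rw [rss, FiniteMeasure.toMeasure_smul, FiniteMeasure.toMeasure_sum]
    rfl
  rw [h, integral_smul_nnreal_measure, integral_finsetSum_measure]
  · simp only [integral_dirac, subwordAvg, NNReal.smul_def, smul_eq_mul]
    simp
  · exact fun i _ => integrable_dirac (by simp)

variable {w : ℕ → (n : ℕ) × Word A n} {μ : (k : ℕ) → ProbabilityMeasure (Word A (k + 1))}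

theorem RSSTendsto.tendsto_subwordAvg (h : RSSTendsto w μ) {k : ℕ} {f : Word A (k + 1) → ℝ}
    (hf : Continuous f) {C : ℝ} (hC : ∀ v, |f v| ≤ C) :
    Tendsto (fun m => subwordAvg (k + 1) f (w m).2) atTop (𝓝 (∫ v, f v ∂(μ k : Measure _))) := by
  have := FiniteMeasure.tendsto_iff_forall_integral_tendsto.1 (h.2 k)
    (BoundedContinuousFunction.ofNormedAddCommGroup f hf C hC)
  simpa [integral_rss] using this

/-- Consistency is exact for the subword laws of a long enough finite word, and erasure averages of
continuous functions are continuous. -/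
theorem RSSTendsto.consistent (h : RSSTendsto w μ) :
    Consistent fun n => (μ n : Measure (Word A (n + 1))) := by
  intro n
  have : IsFiniteMeasure (((n + 1 + 1 : ℕ) : ℝ≥0∞)⁻¹ • ∑ i,
      (μ (n + 1) : Measure (Word A (n + 1 + 1))).map fun w => erase w i) :=
    Measure.smul_finite _ (by simp)
  refine ext_of_forall_integral_eq_of_IsFiniteMeasure fun f => ?_
  rw [integral_smul_sum_map (fun i => measurable_erase i) f.continuous.measurable (bcf_abs_le f)]
  have hc : Continuous (eraseAvg f : Word A (n + 1 + 1) → ℝ) :=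
    continuous_const.mul (continuous_finsetSum _ fun i _ => f.continuous.comp (continuous_erase i))
  refine tendsto_nhds_unique (h.tendsto_subwordAvg f.continuous (bcf_abs_le f))
    ((h.tendsto_subwordAvg hc (abs_eraseAvg_le (bcf_abs_le f))).congr' ?_)
  filter_upwards [h.1.eventually_ge_atTop (n + 1 + 1)] with m hm
  exact subwordAvg_eraseAvg hm f _

theorem RSSTendsto.integral_sq_le (h : RSSTendsto w μ) {k n : ℕ} (hkn : k ≤ n)
    (f : BoundedContinuousFunction (Word A (k + 1)) ℝ) :
    ∫ v, subwordAvg (k + 1) f v ^ 2 ∂(μ n : Measure (Word A (n + 1))) ≤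
      (∫ v, f v ∂(μ k : Measure (Word A (k + 1)))) ^ 2 +
        (2 * ((k + 1 : ℕ) : ℝ) * ‖f‖) ^ 2 / ((n + 1 : ℕ) : ℝ) := by
  have hC : ∀ v : Word A (n + 1), |subwordAvg (k + 1) f v ^ 2| ≤ ‖f‖ ^ 2 := fun v => by
    rw [abs_pow]
    exact pow_le_pow_left₀ (abs_nonneg _) (abs_subwordAvg_le (norm_nonneg _) (bcf_abs_le f) v) 2
  refine le_of_tendsto_of_tendsto
    (h.tendsto_subwordAvg ((continuous_subwordAvg _ f.continuous).pow 2) hC)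
    (((h.tendsto_subwordAvg f.continuous (bcf_abs_le f)).pow 2).add_const _) ?_
  filter_upwards [h.1.eventually_ge_atTop (n + 1)] with m hm
  exact subwordAvg_sq_le (Nat.succ_le_succ hkn) n.succ_pos hm (bcf_abs_le f) _

/-- A general erased-word process whose word marginals form a Martin boundary point is ergodic. -/
theorem mem_ergodicGEWPLaws_of_martinBoundary {Q : Measure (PathSpace A)} (hQ : Q ∈ gewpLaws A)
    (hμ : μ ∈ martinBoundary A) (hm : HasWordMarginals Q μ) : Q ∈ ergodicGEWPLaws A := by
  obtain ⟨w, hw⟩ := hμ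
  refine ⟨hQ, fun Q₁ hQ₁ Q₂ hQ₂ hseg => ?_⟩
  obtain ⟨a, b, ha, hb, hab, rfl⟩ := hseg
  have := isProbabilityMeasure_of_mem_gewpLaws hQ₁
  have hcons := consistent_wordLaw hQ₁
  refine eq_of_wordLaw_eq hQ₁ hQ fun k => ?_
  have hmk : ∀ n, wordLaw (a • Q₁ + b • Q₂) n = (μ n : Measure (Word A (n + 1))) := hm
  -- Domination by the mixture transfers variance bounds to the component, up to the factor `a`.
  have hle : ∀ n, a • wordLaw Q₁ n ≤ (μ n : Measure (Word A (n + 1))) := fun n => by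
    rw [← hmk n, wordLaw, wordLaw, Measure.map_add _ _ (measurable_pathWord n), Measure.map_smul]
    exact Measure.le_add_right le_rfl
  rw [hmk]
  refine ext_of_forall_integral_eq_of_IsFiniteMeasure fun f => ?_
  set c := ∫ v, f v ∂(μ k : Measure (Word A (k + 1))) with hc
  set K := (2 * ((k + 1 : ℕ) : ℝ) * ‖f‖) ^ 2
  -- By consistency the left side is the same for every `n`; Jensen and domination bound it by a
  -- variance that vanishes.
  have hbound : ∀ n, k ≤ n → a * (∫ v, f v ∂wordLaw Q₁ k - c) ^ 2 ≤ K / ((n + 1 : ℕ) : ℝ) := by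
    intro n hn
    have hmeas : Measurable (subwordAvg (k + 1) f : Word A (n + 1) → ℝ) :=
      measurable_subwordAvg _ f.continuous.measurable
    have hb1 := abs_subwordAvg_le (n := n + 1) (norm_nonneg _) (bcf_abs_le f)
    have hi : ∀ (ν : Measure (Word A (n + 1))) [IsFiniteMeasure ν],
        Integrable (subwordAvg (k + 1) f) ν := fun ν _ => integrable_of_abs_le hmeas hb1
    have hi2 : ∀ (ν : Measure (Word A (n + 1))) [IsFiniteMeasure ν],
        Integrable (fun v => subwordAvg (k + 1) f v ^ 2) ν := fun ν _ =>
      integrable_of_abs_le (hmeas.pow_const 2) (C := ‖f‖ ^ 2) fun v => by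
        rw [abs_pow]
        exact pow_le_pow_left₀ (abs_nonneg _) (hb1 v) 2
    have hi3 : ∀ (ν : Measure (Word A (n + 1))) [IsFiniteMeasure ν],
        Integrable (fun v => (subwordAvg (k + 1) f v - c) ^ 2) ν := fun ν _ =>
      integrable_sub_sq (hi ν) (hi2 ν) c
    have hvar : ∫ v, (subwordAvg (k + 1) f v - c) ^ 2 ∂(μ n : Measure (Word A (n + 1))) ≤
        K / ((n + 1 : ℕ) : ℝ) := by
      rw [integral_sub_sq (hi _) (hi2 _), ← hw.consistent.integral_subwordAvg hn
        f.continuous.measurable (bcf_abs_le f), ← hc]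
      have := hw.integral_sq_le hn f
      linarith
    calc (a : ℝ) * (∫ v, f v ∂wordLaw Q₁ k - c) ^ 2
        = a * (∫ v, (subwordAvg (k + 1) f v - c) ∂wordLaw Q₁ n) ^ 2 := by
          rw [integral_sub (hi _) (integrable_const _), integral_const,
            ← hcons.integral_subwordAvg hn f.continuous.measurable (bcf_abs_le f)]
          simp
      _ ≤ a * ∫ v, (subwordAvg (k + 1) f v - c) ^ 2 ∂wordLaw Q₁ n := by
          gcongr
          exact sq_integral_le ((hi _).sub (integrable_const _)) (hi3 _)
      _ = ∫ v, (subwordAvg (k + 1) f v - c) ^ 2 ∂(a • wordLaw Q₁ n) := by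
          rw [integral_smul_nnreal_measure, NNReal.smul_def, smul_eq_mul]
      _ ≤ ∫ v, (subwordAvg (k + 1) f v - c) ^ 2 ∂(μ n : Measure (Word A (n + 1))) :=
          integral_mono_measure (hle n) (Eventually.of_forall fun v => sq_nonneg _) (hi3 _)
      _ ≤ K / ((n + 1 : ℕ) : ℝ) := hvar
  have hlim : Tendsto (fun n : ℕ => K / ((n + 1 : ℕ) : ℝ)) atTop (𝓝 0) :=
    (tendsto_const_div_atTop_nhds_zero_nat K).comp (tendsto_add_atTop_nat 1)
  have h0 : (a : ℝ) * (∫ v, f v ∂wordLaw Q₁ k - c) ^ 2 ≤ 0 :=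
    ge_of_tendsto hlim ((eventually_ge_atTop k).mono hbound)
  have ha' : (0 : ℝ) < a := ha
  have : (∫ v, f v ∂wordLaw Q₁ k - c) ^ 2 = 0 :=
    le_antisymm (by by_contra! hcon; nlinarith [mul_pos ha' hcon]) (sq_nonneg _)
  exact sub_eq_zero.1 (pow_eq_zero_iff two_ne_zero |>.1 this)

end Boundary

end

section

/-! ### Ergodic laws have Martin boundary marginals -/

section L2

variable {Ω : Type*} [MeasurableSpace Ω] {P : Measure Ω}

theorem ext_of_forall_integral_measurable {μ ν : Measure Ω} [IsFiniteMeasure μ] [IsFiniteMeasure ν]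
    (h : ∀ g : Ω → ℝ, Measurable g → (∀ x, |g x| ≤ 1) → ∫ x, g x ∂μ = ∫ x, g x ∂ν) : μ = ν := by
  ext S hS
  have := h (S.indicator 1) (measurable_one.indicator hS) fun x => by
    by_cases hx : x ∈ S <;> simp [hx]
  rw [integral_indicator_one hS, integral_indicator_one hS] at this
  exact (measureReal_eq_measureReal_iff).1 this

/-- A bounded sequence with the orthogonality relations of a reverse martingale converges weakly
in `L²` to a bounded function. -/
theorem exists_tendsto_integral_mul [IsProbabilityMeasure P] {M : ℕ → Ω → ℝ}
    (hM : ∀ n, Measurable (M n)) {C : ℝ} (hC : ∀ n ω, |M n ω| ≤ C)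
    (horth : ∀ n m, n ≤ m → ∫ ω, M n ω * M m ω ∂P = ∫ ω, M m ω ^ 2 ∂P) :
    ∃ h : Ω → ℝ, Measurable h ∧ (∀ ω, |h ω| ≤ C) ∧
      ∀ (Z : Ω → ℝ), Measurable Z → ∀ D, (∀ ω, |Z ω| ≤ D) →
        Tendsto (fun n => ∫ ω, Z ω * M n ω ∂P) atTop (𝓝 (∫ ω, Z ω * h ω ∂P)) := by
  have hL : ∀ {Z : Ω → ℝ}, Measurable Z → ∀ {D : ℝ}, (∀ ω, |Z ω| ≤ D) → MemLp Z 2 P :=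
    fun hZ D hD => MemLp.of_bound hZ.aestronglyMeasurable D (Eventually.of_forall hD)
  let X : ℕ → Lp ℝ 2 P := fun n => (hL (hM n) (hC n)).toLp
  have inner_toLp : ∀ {Z Z' : Ω → ℝ} (hZ : MemLp Z 2 P) (hZ' : MemLp Z' 2 P),
      inner ℝ hZ.toLp hZ'.toLp = ∫ ω, Z ω * Z' ω ∂P := by
    intro Z Z' hZ hZ'
    rw [L2.inner_def]
    refine integral_congr_ae ?_
    filter_upwards [hZ.coeFn_toLp, hZ'.coeFn_toLp] with ω h1 h2
    rw [h1, h2]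
    simp [mul_comm]
  let a : ℕ → ℝ := fun n => ∫ ω, M n ω ^ 2 ∂P
  have hX : ∀ n m, n ≤ m → inner ℝ (X n) (X m) = a m := fun n m hnm => by
    rw [inner_toLp, horth n m hnm]
  -- Squared distances are differences of the decreasing sequence `a`, so the sequence is Cauchy in
  -- `L²`.
  have hdist : ∀ n m, n ≤ m → ‖X n - X m‖ ^ 2 = a n - a m := by
    intro n m hnm
    rw [norm_sub_sq_real, hX n m hnm, ← real_inner_self_eq_norm_sq, ← real_inner_self_eq_norm_sq,
      hX n n le_rfl, hX m m le_rfl]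
    ring
  have ha : Antitone a := fun n m hnm => by
    have := hdist n m hnm
    nlinarith [sq_nonneg ‖X n - X m‖]
  have hlim : Tendsto a atTop (𝓝 (⨅ n, a n)) :=
    tendsto_atTop_ciInf ha ⟨0, by rintro _ ⟨n, rfl⟩; exact integral_nonneg fun ω => sq_nonneg _⟩
  have hcau : CauchySeq X := by
    have := hlim.cauchySeq
    rw [Metric.cauchySeq_iff'] at this ⊢
    intro ε hε
    obtain ⟨N, hN⟩ := this (ε ^ 2) (by positivity)
    refine ⟨N, fun n hn => ?_⟩
    have h1 := hN n hn
    rw [Real.dist_eq, abs_sub_comm] at h1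
    have h2 := hdist N n hn
    rw [dist_comm, dist_eq_norm]
    refine lt_of_pow_lt_pow_left₀ 2 hε.le ?_
    rw [h2]
    exact (le_abs_self _).trans_lt h1
  obtain ⟨h₀, hh₀⟩ := cauchySeq_tendsto_of_complete hcau
  have hweak : ∀ (Z : Ω → ℝ), Measurable Z → ∀ D, (∀ ω, |Z ω| ≤ D) →
      Tendsto (fun n => ∫ ω, Z ω * M n ω ∂P) atTop (𝓝 (∫ ω, Z ω * h₀ ω ∂P)) := by
    intro Z hZ D hD
    have h1 : Tendsto (fun n => inner ℝ (hL hZ hD).toLp (X n)) atTop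
        (𝓝 (inner ℝ (hL hZ hD).toLp h₀)) := tendsto_const_nhds.inner hh₀
    have h2 : inner ℝ (hL hZ hD).toLp h₀ = ∫ ω, Z ω * h₀ ω ∂P := by
      rw [L2.inner_def]
      refine integral_congr_ae ?_
      filter_upwards [(hL hZ hD).coeFn_toLp] with ω h1
      rw [h1]
      simp [mul_comm]
    rw [← h2]
    simpa only [X, inner_toLp] using h1
  have hint : Integrable h₀ P := (Lp.memLp h₀).integrable one_le_two
  -- Testing against indicators carries the bounds `±C` over to the limit almost everywhere.
  have hset : ∀ S, MeasurableSet S →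
      Tendsto (fun n => ∫ ω in S, M n ω ∂P) atTop (𝓝 (∫ ω in S, h₀ ω ∂P)) := by
    intro S hS
    have := hweak (S.indicator 1) (measurable_one.indicator hS) 1 fun x => by
      by_cases hx : x ∈ S <;> simp [hx]
    have e : ∀ g : Ω → ℝ, ∫ ω, S.indicator 1 ω * g ω ∂P = ∫ ω in S, g ω ∂P := by
      intro g
      rw [← integral_indicator hS]
      congr 1
      funext ω
      by_cases hx : ω ∈ S <;> simp [hx]
    simpa only [e] using this
  have hMi : ∀ n, Integrable (M n) P := fun n => integrable_of_abs_le (hM n) (hC n)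
  have hup : h₀ ≤ᵐ[P] fun _ => C :=
    ae_le_of_forall_setIntegral_le hint (integrable_const C) fun S hS _ =>
      le_of_tendsto' (hset S hS) fun n => integral_mono (hMi n).integrableOn
        (integrable_const C).integrableOn fun ω => (le_abs_self _).trans (hC n ω)
  have hlow : (fun _ => -C) ≤ᵐ[P] h₀ :=
    ae_le_of_forall_setIntegral_le (integrable_const (-C)) hint fun S hS _ =>
      ge_of_tendsto' (hset S hS) fun n => integral_mono (integrable_const (-C)).integrableOn
        (hMi n).integrableOn fun ω => (abs_le.1 (hC n ω)).1
  have hC0 : 0 ≤ C := by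
    obtain ⟨ω⟩ := nonempty_of_isProbabilityMeasure P
    exact (abs_nonneg _).trans (hC 0 ω)
  -- Truncation changes `h₀` only on a null set and makes the bound hold everywhere.
  refine ⟨fun ω => max (-C) (min C (h₀ ω)), ?_, fun ω => ?_, fun Z hZ D hD => ?_⟩
  · exact measurable_const.max (measurable_const.min (Lp.stronglyMeasurable h₀).measurable)
  · rw [abs_le]
    exact ⟨le_max_left _ _, max_le (by linarith) (min_le_left _ _)⟩
  · have : ∫ ω, Z ω * max (-C) (min C (h₀ ω)) ∂P = ∫ ω, Z ω * h₀ ω ∂P := by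
      refine integral_congr_ae ?_
      filter_upwards [hup, hlow] with ω h1 h2
      change h₀ ω ≤ C at h1
      change -C ≤ h₀ ω at h2
      rw [min_eq_right h1, max_eq_right h2]
    rw [this]
    exact hweak Z hZ D hD

end L2

/-! ### Vanishing variance of subword averages under an ergodic law -/

section Measurable

variable [MeasurableSpace A]

theorem abs_mul_le_mul {a b C D : ℝ} (ha : |a| ≤ C) (hb : |b| ≤ D) : |a * b| ≤ C * D := by
  rw [abs_mul]
  exact mul_le_mul ha hb (abs_nonneg _) ((abs_nonneg _).trans ha)

/-- The conditional expectation of `g (W n)` given `W m` is the subword average; one erasure at a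
time, the level climbs from `n` to `m`. -/
theorem IsGEWP.integral_mul_eq {Ω : Type u} [MeasurableSpace Ω] {P : Measure Ω}
    [IsProbabilityMeasure P] {W : (n : ℕ) → Ω → Word A (n + 1)} {η : (n : ℕ) → Ω → Fin (n + 1)}
    (h : IsGEWP P W η) {n m : ℕ} (hnm : n ≤ m) {g : Word A (n + 1) → ℝ} (hg : Measurable g) {C : ℝ}
    (hC : ∀ v, |g v| ≤ C) {G : Word A (m + 1) → ℝ} (hG : Measurable G) {D : ℝ}
    (hD : ∀ v, |G v| ≤ D) :
    ∫ ω, g (W n ω) * G (W m ω) ∂P = ∫ ω, subwordAvg (n + 1) g (W m ω) * G (W m ω) ∂P := by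
  have hC0 : 0 ≤ C := by
    obtain ⟨ω⟩ := nonempty_of_isProbabilityMeasure P
    exact (abs_nonneg _).trans (hC (W n ω))
  have key : ∀ j, n ≤ j → j ≤ m →
      ∫ ω, g (W n ω) * G (W m ω) ∂P = ∫ ω, subwordAvg (n + 1) g (W j ω) * G (W m ω) ∂P := by
    intro j hj
    induction j, hj using Nat.le_induction with
    | base => intro _; simp only [subwordAvg_self]
    | succ j hj ih =>
      intro hjm
      rw [ih (by omega)]
      have hΦ : Measurable fun p : Word A (j + 1) × Word A (m + 1) =>
          subwordAvg (n + 1) g p.1 * G p.2 :=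
        ((measurable_subwordAvg _ hg).comp measurable_fst).mul (hG.comp measurable_snd)
      have hΦb : ∀ p : Word A (j + 1) × Word A (m + 1),
          |subwordAvg (n + 1) g p.1 * G p.2| ≤ C * D := fun p =>
        abs_mul_le_mul (abs_subwordAvg_le hC0 hC _) (hD _)
      have e1 : ∫ ω, subwordAvg (n + 1) g (W j ω) * G (W m ω) ∂P =
          ∫ p, subwordAvg (n + 1) g p.1 * G p.2 ∂P.map (fun ω => (W j ω, W m ω)) :=
        (integral_map ((h.measurable_word j).prodMk (h.measurable_word m)).aemeasurable
          hΦ.aestronglyMeasurable).symm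
      have he : ∀ i, Measurable fun ω => erase (W (j + 1) ω) i := fun i =>
        (measurable_erase i).comp (h.measurable_word (j + 1))
      rw [e1, h.map_word_prodMk j (measurable_word_backwardFiltration hjm),
        integral_smul_sum_map (fun i => (he i).prodMk (h.measurable_word m)) hΦ hΦb]
      refine integral_congr_ae (Eventually.of_forall fun ω => ?_)
      simp only
      rw [← eraseAvg_subwordAvg (Nat.succ_le_succ hj), eraseAvg, ← Finset.sum_mul, mul_assoc]
  exact key m hnm le_rfl

theorem consistent_of_integral {μ : (n : ℕ) → Measure (Word A (n + 1))}
    [∀ n, IsFiniteMeasure (μ n)]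
    (h : ∀ n (g : Word A (n + 1) → ℝ), Measurable g → (∀ x, |g x| ≤ 1) →
      ∫ x, g x ∂μ n = ∫ x, eraseAvg g x ∂μ (n + 1)) : Consistent μ := by
  intro n
  have : IsFiniteMeasure (((n + 1 + 1 : ℕ) : ℝ≥0∞)⁻¹ • ∑ i,
      (μ (n + 1)).map fun w => erase w i) :=
    Measure.smul_finite _ (by simp)
  refine ext_of_forall_integral_measurable fun g hg hg1 => ?_
  rw [integral_smul_sum_map (fun i => measurable_erase i) hg hg1, h n g hg hg1]
  rfl

theorem measurable_eraseAvg {n : ℕ} {g : Word A n → ℝ} (hg : Measurable g) :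
    Measurable (eraseAvg g) :=
  measurable_const.mul (Finset.measurable_sum _ fun i _ => hg.comp (measurable_erase i))

/-- For an ergodic process the laws of random subwords of `W_n` converge to the law of `W_k`. -/
theorem tendsto_integral_sub_sq [StandardBorelSpace A] {Q : Measure (PathSpace A)}
    (hQ : Q ∈ ergodicGEWPLaws A) {k : ℕ} {f : Word A (k + 1) → ℝ} (hf : Measurable f) {C : ℝ}
    (hC : ∀ v, |f v| ≤ C) :
    Tendsto (fun n => ∫ v, (subwordAvg (k + 1) f v - ∫ v, f v ∂wordLaw Q k) ^ 2 ∂wordLaw Q n)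
      atTop (𝓝 0) := by
  obtain ⟨⟨Ω, _, P, W, η, hP, hG, hPQ⟩, hext⟩ := hQ
  have hQ : Q ∈ gewpLaws A := ⟨Ω, _, P, W, η, hP, hG, hPQ⟩
  have hPr := isProbabilityMeasure_of_mem_gewpLaws hQ
  have hw : ∀ n, wordLaw Q n = P.map (W n) := fun n => by rw [hPQ, wordLaw_map hG]
  have hC0 : 0 ≤ C := by
    obtain ⟨ω⟩ := nonempty_of_isProbabilityMeasure P
    exact (abs_nonneg _).trans (hC (W k ω))
  have hcons := consistent_wordLaw hQ
  have hUm : ∀ n, Measurable (subwordAvg (k + 1) f : Word A (n + 1) → ℝ) := fun n =>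
    measurable_subwordAvg _ hf
  have hUb : ∀ n (v : Word A (n + 1)), |subwordAvg (k + 1) f v| ≤ C := fun n =>
    abs_subwordAvg_le hC0 hC
  -- The shift by `k` makes every word long enough to have subwords of length `k + 1`.
  let M : ℕ → Ω → ℝ := fun n ω => subwordAvg (k + 1) f (W (n + k) ω)
  have hM : ∀ n, Measurable (M n) := fun n => (hUm _).comp (hG.measurable_word _)
  have hMb : ∀ n ω, |M n ω| ≤ C := fun n ω => hUb _ _
  have hM2 : ∀ n, Integrable (fun ω => M n ω ^ 2) P := fun n =>
    integrable_of_abs_le ((hM n).pow_const 2) (C := C ^ 2) fun ω => by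
      rw [abs_pow]
      exact pow_le_pow_left₀ (abs_nonneg _) (hMb n ω) 2
  set c := ∫ v, f v ∂wordLaw Q k with hc
  have hMc : ∀ n, ∫ ω, M n ω ∂P = c := by
    intro n
    rw [hc, hcons.integral_subwordAvg (Nat.le_add_left k n) hf hC, hw,
      integral_map (hG.measurable_word _).aemeasurable (hUm _).aestronglyMeasurable]
  obtain ⟨h, hhm, hhb, hlim⟩ := exists_tendsto_integral_mul hM hMb fun n m hnm => by
    simp only [M]
    rw [hG.integral_mul_eq (by omega) (hUm _) (hUb _) (hUm _) (hUb _)]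
    simp only [subwordAvg_subwordAvg (show k + 1 ≤ n + k + 1 by omega)
      (show n + k + 1 ≤ m + k + 1 by omega), sq]
  have hhi : Integrable h P := integrable_of_abs_le hhm hhb
  have hhc : ∫ ω, h ω ∂P = c := by
    have := hlim (fun _ => 1) measurable_const 1 fun _ => by simp
    simp only [one_mul, hMc] at this
    exact tendsto_nhds_unique this tendsto_const_nhds
  have hcb : |c| ≤ C := by
    have := norm_integral_le_of_norm_le_const (μ := P) (f := M 0) (C := C)
      (Eventually.of_forall fun ω => hMb 0 ω)
    simpa [hMc 0] using this
  -- With `M m` in place of `h`, both sides are the same subword average at a high level; `h`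
  -- inherits the identity as a weak limit, so weighting by it respects erasure.
  have hgh : ∀ n (g : Word A (n + 1) → ℝ), Measurable g → (∀ x, |g x| ≤ 1) →
      ∫ ω, g (W n ω) * h ω ∂P = ∫ ω, eraseAvg g (W (n + 1) ω) * h ω ∂P := by
    intro n g hg hg1
    refine tendsto_nhds_unique (hlim _ (hg.comp (hG.measurable_word n)) 1 fun _ => hg1 _)
      ((hlim _ ((measurable_eraseAvg hg).comp (hG.measurable_word (n + 1))) 1
        fun _ => abs_eraseAvg_le hg1 _).congr' ?_)
    filter_upwards [eventually_ge_atTop (n + 1)] with m hm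
    simp only [M, Function.comp_apply]
    rw [hG.integral_mul_eq (show n ≤ m + k by omega) hg hg1 (hUm _) (hUb _),
      hG.integral_mul_eq (show n + 1 ≤ m + k by omega) (measurable_eraseAvg hg)
        (abs_eraseAvg_le hg1) (hUm _) (hUb _)]
    simp only [subwordAvg_eraseAvg (show n + 1 + 1 ≤ m + k + 1 by omega)]
  have hg1 : ∀ n (g : Word A (n + 1) → ℝ), Measurable g → (∀ x, |g x| ≤ 1) →
      ∫ ω, g (W n ω) ∂P = ∫ ω, eraseAvg g (W (n + 1) ω) ∂P := by
    intro n g hg hg1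
    have := hcons.integral_eraseAvg n hg hg1
    rwa [hw, hw, integral_map (hG.measurable_word _).aemeasurable hg.aestronglyMeasurable,
      integral_map (hG.measurable_word _).aemeasurable
        (measurable_eraseAvg hg).aestronglyMeasurable] at this
  -- the reweighted processes
  have main : ∀ s : ℝ, |s| * (2 * C) ≤ 1 → ∃ Q' ∈ gewpLaws A,
      ∀ n (g : Word A (n + 1) → ℝ), Measurable g → (∀ x, |g x| ≤ max 1 C) →
        ∫ v, g v ∂wordLaw Q' n =
          ∫ ω, g (W n ω) ∂P + s * (∫ ω, g (W n ω) * h ω ∂P - c * ∫ ω, g (W n ω) ∂P) := by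
    intro s hs
    -- It has mean `1` since `h` has mean `c`, and is nonnegative since `|h - c| ≤ 2 * C`.
    let ρ : Ω → ℝ := fun ω => 1 + s * (h ω - c)
    have hρm : Measurable ρ := measurable_const.add (measurable_const.mul (hhm.sub measurable_const))
    have hρ0 : ∀ ω, 0 ≤ ρ ω := by
      intro ω
      have h1 : |s * (h ω - c)| ≤ 1 := by
        rw [abs_mul]
        refine le_trans ?_ hs
        gcongr
        have := abs_sub (h ω) c
        linarith [hhb ω]
      have := neg_le_of_abs_le h1
      change 0 ≤ 1 + s * (h ω - c)
      linarith
    have hsi : Integrable (fun ω => s * (h ω - c)) P :=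
      (hhi.sub (integrable_const c)).const_mul s
    have hρi : Integrable ρ P := (integrable_const 1).add hsi
    have hρ1 : ∫ ω, ρ ω ∂P = 1 := by
      simp only [ρ]
      rw [integral_add (integrable_const _) hsi,
        integral_const_mul, integral_sub hhi (integrable_const c), hhc]
      simp
    let P' : Measure Ω := P.withDensity fun ω => ((ρ ω).toNNReal : ℝ≥0∞)
    have hP' : IsProbabilityMeasure P' := by
      constructor
      rw [withDensity_apply _ MeasurableSet.univ, Measure.restrict_univ]
      change ∫⁻ ω, ENNReal.ofReal (ρ ω) ∂P = 1
      rw [← ofReal_integral_eq_lintegral_ofReal hρi (Eventually.of_forall hρ0), hρ1,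
        ENNReal.ofReal_one]
    let μ : (n : ℕ) → Measure (Word A (n + 1)) := fun n => P'.map (W n)
    have hμp : ∀ n, IsProbabilityMeasure (μ n) := fun n =>
      Measure.isProbabilityMeasure_map (hG.measurable_word n).aemeasurable
    -- The bound `max 1 C` admits both the test functions bounded by `1` and `f` itself.
    have hint : ∀ n (g : Word A (n + 1) → ℝ), Measurable g → (∀ x, |g x| ≤ max 1 C) →
        ∫ v, g v ∂μ n =
          ∫ ω, g (W n ω) ∂P + s * (∫ ω, g (W n ω) * h ω ∂P - c * ∫ ω, g (W n ω) ∂P) := by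
      intro n g hg hgb
      have hgW : Measurable fun ω => g (W n ω) := hg.comp (hG.measurable_word n)
      have i1 : Integrable (fun ω => g (W n ω)) P := integrable_of_abs_le hgW fun _ => hgb _
      have i2 : Integrable (fun ω => g (W n ω) * h ω) P :=
        integrable_of_abs_le (hgW.mul hhm) fun _ => abs_mul_le_mul (hgb _) (hhb _)
      rw [integral_map (hG.measurable_word n).aemeasurable hg.aestronglyMeasurable,
        integral_withDensity_eq_integral_smul hρm.real_toNNReal]
      have : ∀ ω, (ρ ω).toNNReal • g (W n ω) =
          g (W n ω) + s * (g (W n ω) * h ω - c * g (W n ω)) := by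
        intro ω
        rw [NNReal.smul_def, Real.coe_toNNReal _ (hρ0 ω), smul_eq_mul]
        simp only [ρ]
        ring
      simp only [this]
      have i3 : Integrable (fun ω => s * (g (W n ω) * h ω - c * g (W n ω))) P :=
        (i2.sub (i1.const_mul c)).const_mul s
      rw [integral_add i1 i3, integral_const_mul,
        integral_sub i2 (i1.const_mul c), integral_const_mul]
    have hμc : Consistent μ := consistent_of_integral fun n g hg hgb => by
      rw [hint n g hg fun x => (hgb x).trans (le_max_left _ _),
        hint (n + 1) _ (measurable_eraseAvg hg)
          fun x => (abs_eraseAvg_le hgb x).trans (le_max_left _ _), hgh n g hg hgb, hg1 n g hg hgb]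
    obtain ⟨Q', hQ', hQw⟩ := hμc.exists_gewpLaw
    exact ⟨Q', hQ', fun n g hg hgb => by rw [hQw, hint n g hg hgb]⟩
  obtain ⟨s, hs0, hs⟩ : ∃ s : ℝ, 0 < s ∧ s * (2 * C) ≤ 1 := by
    refine ⟨(2 * C + 1)⁻¹, by positivity, ?_⟩
    rw [inv_mul_le_iff₀ (by positivity)]
    linarith
  obtain ⟨Q₁, hQ₁, h₁⟩ := main s (by rwa [abs_of_pos hs0])
  obtain ⟨Q₂, hQ₂, h₂⟩ := main (-s) (by rwa [abs_neg, abs_of_pos hs0])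
  have hpr₁ := isProbabilityMeasure_of_mem_gewpLaws hQ₁
  have hpr₂ := isProbabilityMeasure_of_mem_gewpLaws hQ₂
  -- The terms in `s` and `-s` cancel.
  have hmix : Q = (2⁻¹ : ℝ≥0) • Q₁ + (2⁻¹ : ℝ≥0) • Q₂ := by
    refine eq_smul_add_smul_of_wordLaw_eq hQ hQ₁ hQ₂ fun n =>
      ext_of_forall_integral_measurable fun g hg hgb => ?_
    have hgb' : ∀ x, |g x| ≤ max 1 C := fun x => (hgb x).trans (le_max_left _ _)
    have hgi : ∀ (ν : Measure (Word A (n + 1))) [IsFiniteMeasure ν], Integrable g ν :=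
      fun ν _ => integrable_of_abs_le hg hgb
    rw [integral_add_measure (hgi _) (hgi _), integral_smul_nnreal_measure,
      integral_smul_nnreal_measure, h₁ n g hg hgb', h₂ n g hg hgb', hw,
      integral_map (hG.measurable_word n).aemeasurable hg.aestronglyMeasurable]
    simp only [NNReal.smul_def, smul_eq_mul, NNReal.coe_inv, NNReal.coe_ofNat]
    ring
  have hQ₁Q : Q₁ = Q := hext hQ₁ hQ₂
    ⟨2⁻¹, 2⁻¹, by positivity, by positivity, by rw [← two_mul]; simp, hmix.symm⟩
  -- Since the weighted law equals `Q`, its correction term vanishes on `f`.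
  have hfh : ∫ ω, f (W k ω) * h ω ∂P = c ^ 2 := by
    have e := h₁ k f hf fun x => (hC x).trans (le_max_right _ _)
    have e' : ∫ ω, f (W k ω) ∂P = c := by
      rw [hc, hw, integral_map (hG.measurable_word k).aemeasurable hf.aestronglyMeasurable]
    rw [hQ₁Q, ← hc, e'] at e
    have : s * (∫ ω, f (W k ω) * h ω ∂P - c * c) = 0 := by linarith
    rcases mul_eq_zero.1 this with h0 | h0
    · exact absurd h0 hs0.ne'
    · linarith
  -- The second moment of `M n` is its correlation with `f (W k)`, which converges to that of `h`.
  have hsq : Tendsto (fun n => ∫ ω, M n ω ^ 2 ∂P) atTop (𝓝 (c ^ 2)) := by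
    rw [← hfh]
    refine (hlim _ (hf.comp (hG.measurable_word k)) C fun _ => hC _).congr fun n => ?_
    simp only [M, Function.comp_apply]
    rw [hG.integral_mul_eq (Nat.le_add_left k n) hf hC (hUm _) (hUb _)]
    simp only [sq]
  rw [← tendsto_add_atTop_iff_nat k]
  have hfin : ∀ n, ∫ v, (subwordAvg (k + 1) f v - c) ^ 2 ∂wordLaw Q (n + k) =
      ∫ ω, M n ω ^ 2 ∂P - c ^ 2 := by
    intro n
    have hm : Measurable fun v : Word A (n + k + 1) => (subwordAvg (k + 1) f v - c) ^ 2 :=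
      ((hUm _).sub measurable_const).pow_const 2
    rw [hw, integral_map (hG.measurable_word _).aemeasurable hm.aestronglyMeasurable]
    have := integral_sub_sq (integrable_of_abs_le (P := P) (hM n) (hMb n)) (hM2 n) c
    rw [hMc] at this
    rw [this]
    ring
  simp only [hfin]
  have := hsq.sub_const (c ^ 2)
  rwa [sub_self] at this

end Measurable

end

/-! ### Choosing deterministic words that approximate an ergodic law -/

section

section Selection

variable [TopologicalSpace A] [PolishSpace A] [MeasurableSpace A] [BorelSpace A]

theorem isProbabilityMeasure_rss {n k : ℕ} (h : k ≤ n) (w : Word A n) :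
    IsProbabilityMeasure (rss w k : Measure (Word A k)) := by
  have h1 := integral_rss w k fun _ => 1
  have h2 := choose_mul_subwordAvg h (fun _ : Word A k => (1 : ℝ)) w
  have hn : (n.choose k : ℝ) ≠ 0 := by exact_mod_cast (Nat.choose_pos h).ne'
  rw [Finset.sum_const, Finset.card_univ, card_orderEmbedding, nsmul_eq_mul] at h2
  rw [mul_left_cancel₀ hn h2, integral_const, smul_eq_mul, mul_one] at h1
  exact ⟨(ENNReal.toReal_eq_one_iff _).1 h1⟩

/-- Finite intersections of sets from a countable basis of the topology. -/
def basisInter (X : Type*) [TopologicalSpace X] [SecondCountableTopology X]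
    (t : Finset (TopologicalSpace.countableBasis X)) : Set X :=
  ⋂ s ∈ t, (s : Set X)

theorem isOpen_basisInter {X : Type*} [TopologicalSpace X] [SecondCountableTopology X]
    (t : Finset (TopologicalSpace.countableBasis X)) : IsOpen (basisInter X t) :=
  isOpen_biInter_finset fun s _ => TopologicalSpace.isOpen_of_mem_countableBasis s.2

/-- Finite intersections of basic open sets form a countable π-system that determines weak
convergence, so countably many statistics are enough. -/
theorem tendsto_of_basisInter {X : Type*} [TopologicalSpace X] [SecondCountableTopology X]
    [MeasurableSpace X] [OpensMeasurableSpace X] {p : ℕ → ProbabilityMeasure X}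
    {q : ProbabilityMeasure X}
    (h : ∀ t, Tendsto (fun m => (p m : Measure X).real (basisInter X t)) atTop
      (𝓝 ((q : Measure X).real (basisInter X t)))) : Tendsto p atTop (𝓝 q) := by
  classical
  refine IsPiSystem.tendsto_probabilityMeasure_of_tendsto_of_mem (S := Set.range (basisInter X))
    ?_ ?_ ?_ ?_
  · rintro _ ⟨t, rfl⟩ _ ⟨t', rfl⟩ _
    refine ⟨t ∪ t', ?_⟩
    ext x
    simp [basisInter, or_imp, forall_and]
  · rintro _ ⟨t, rfl⟩
    exact (isOpen_basisInter t).measurableSet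
  · intro U hU x hx
    obtain ⟨b, hb, hxb, hbU⟩ :=
      (TopologicalSpace.isBasis_countableBasis X).exists_subset_of_mem_open hx hU
    refine ⟨b, ⟨{⟨b, hb⟩}, by simp [basisInter]⟩, ?_, hbU⟩
    exact (TopologicalSpace.isOpen_of_mem_countableBasis hb).mem_nhds hxb
  · rintro _ ⟨t, rfl⟩
    rw [← NNReal.tendsto_coe]
    exact h t

/-- The word marginals of an ergodic law form a point of the Martin boundary. -/
theorem exists_martinBoundary_of_ergodic {Q : Measure (PathSpace A)} (hQ : Q ∈ ergodicGEWPLaws A) :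
    ∃ μ ∈ martinBoundary A, HasWordMarginals Q μ := by
  have hPr := isProbabilityMeasure_of_mem_gewpLaws hQ.1
  let μ : (k : ℕ) → ProbabilityMeasure (Word A (k + 1)) := fun k => ⟨wordLaw Q k, inferInstance⟩
  refine ⟨μ, ?_, fun k => rfl⟩
  let f : (i : (k : ℕ) × Finset (TopologicalSpace.countableBasis (Word A (k + 1)))) →
      Word A (i.1 + 1) → ℝ := fun i => (basisInter _ i.2).indicator 1
  have hfm : ∀ i, Measurable (f i) := fun i =>
    measurable_one.indicator (isOpen_basisInter i.2).measurableSet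
  have hfb : ∀ i v, |f i v| ≤ 1 := fun i v => by
    simp only [f]
    by_cases hv : v ∈ basisInter _ i.2 <;> simp [hv]
  have hne : Nonempty ((k : ℕ) × Finset (TopologicalSpace.countableBasis (Word A (k + 1)))) :=
    ⟨⟨0, ∅⟩⟩
  obtain ⟨e, he⟩ := exists_surjective_nat
    ((k : ℕ) × Finset (TopologicalSpace.countableBasis (Word A (k + 1))))
  let D : (j : ℕ) → (n : ℕ) → Word A (n + 1) → ℝ := fun j n v =>
    (subwordAvg ((e j).1 + 1) (f (e j)) v - ∫ v, f (e j) v ∂wordLaw Q (e j).1) ^ 2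
  have hDi : ∀ j n, Integrable (D j n) (wordLaw Q n) := fun j n =>
    integrable_sub_sq (integrable_of_abs_le (measurable_subwordAvg _ (hfm _))
      (abs_subwordAvg_le zero_le_one (hfb _)))
      (integrable_of_abs_le ((measurable_subwordAvg _ (hfm _)).pow_const 2) (C := 1) fun v => by
        rw [abs_pow]
        exact pow_le_one₀ (abs_nonneg _) (abs_subwordAvg_le zero_le_one (hfb _) v)) _
  -- First-moment method: the first `m + 1` variances have a small sum for large `n`, and some word
  -- does no worse than the mean. No almost sure convergence is needed.
  have hsel : ∀ m : ℕ, ∃ n, m ≤ n ∧ ∃ v : Word A (n + 1), ∀ j ≤ m, D j n v ≤ 1 / ((m : ℝ) + 1) := by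
    intro m
    have hlim : Tendsto (fun n => ∑ j ∈ Finset.range (m + 1), ∫ v, D j n v ∂wordLaw Q n) atTop
        (𝓝 (∑ j ∈ Finset.range (m + 1), 0)) :=
      tendsto_finsetSum _ fun j _ => tendsto_integral_sub_sq hQ (hfm _) (hfb _)
    rw [Finset.sum_const_zero] at hlim
    obtain ⟨n, hn, hmn⟩ := ((hlim.eventually_lt_const
      (show (0 : ℝ) < 1 / ((m : ℝ) + 1) by positivity)).and (eventually_ge_atTop m)).exists
    rw [← integral_finsetSum _ fun j _ => hDi j n] at hn
    obtain ⟨v, hv⟩ := exists_le_integral (μ := wordLaw Q n)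
      (integrable_finsetSum (Finset.range (m + 1)) fun j _ => hDi j n)
    refine ⟨n, hmn, v, fun j hj => ?_⟩
    refine (Finset.single_le_sum (f := fun j => D j n v) (fun i _ => sq_nonneg _)
      (Finset.mem_range.2 (Nat.lt_succ_of_le hj))).trans (le_trans ?_ hn.le)
    simpa using hv
  choose N hN v hv using hsel
  have hNlim : Tendsto (fun m => N m + 1) atTop atTop :=
    tendsto_atTop_mono (fun m => (hN m).trans (Nat.le_succ _)) tendsto_id
  have hconv : ∀ i, Tendsto (fun m => subwordAvg (i.1 + 1) (f i) (v m)) atTop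
      (𝓝 (∫ v, f i v ∂wordLaw Q i.1)) := by
    intro i
    obtain ⟨j, rfl⟩ := he i
    have h1 : Tendsto (fun m => D j (N m) (v m)) atTop (𝓝 0) := by
      refine tendsto_of_tendsto_of_tendsto_of_le_of_le' tendsto_const_nhds
        tendsto_one_div_add_atTop_nhds_zero_nat (Eventually.of_forall fun m => sq_nonneg _) ?_
      filter_upwards [eventually_ge_atTop j] with m hm
      exact hv m j hm
    have h2 := h1.sqrt
    simp only [D, Real.sqrt_sq_eq_abs, Real.sqrt_zero] at h2
    exact tendsto_sub_nhds_zero_iff.1 ((tendsto_zero_iff_abs_tendsto_zero _).2 h2)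
  refine ⟨fun m => ⟨N m + 1, v m⟩, hNlim, fun k => ?_⟩
  classical
  -- The value `μ k` fills in for words too short to have a subword of length `k + 1`, which happens
  -- only finitely often.
  let p : ℕ → ProbabilityMeasure (Word A (k + 1)) := fun m =>
    if h : k + 1 ≤ N m + 1 then ⟨rss (v m) (k + 1), isProbabilityMeasure_rss h (v m)⟩ else μ k
  have hp : ∀ m, k + 1 ≤ N m + 1 → (p m).toFiniteMeasure = rss (v m) (k + 1) := fun m hm => by
    have : p m = ⟨rss (v m) (k + 1), isProbabilityMeasure_rss hm (v m)⟩ := dif_pos hm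
    rw [this]
    rfl
  have hpev := hNlim.eventually_ge_atTop (k + 1)
  have hplim : Tendsto p atTop (𝓝 (μ k)) := by
    refine tendsto_of_basisInter fun t => ?_
    have hms : MeasurableSet (basisInter (Word A (k + 1)) t) := (isOpen_basisInter t).measurableSet
    have h2 := hconv ⟨k, t⟩
    simp only [f] at h2
    rw [integral_indicator_one hms] at h2
    refine h2.congr' ?_
    filter_upwards [hpev] with m hm
    rw [← integral_rss, integral_indicator_one hms, ← hp m hm]
    rfl
  have h3 := (ProbabilityMeasure.tendsto_nhds_iff_toFiniteMeasure_tendsto_nhds _).1 hplim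
  refine h3.congr' ?_
  filter_upwards [hpev] with m hm
  exact hp m hm

end Selection

end

end ErasedWord

theorem mainTheorem9 (A : Type u) [TopologicalSpace A] [PolishSpace A] [MeasurableSpace A]
    [BorelSpace A] :
    ErasedWord.ergodicGEWPLaws A = ErasedWord.martinGEWPLaws A ∧
      ErasedWord.martinBoundary A = ErasedWord.minimalBoundary A := by
  refine ⟨Set.Subset.antisymm ?_ ?_, Set.Subset.antisymm ?_ ?_⟩
  · exact fun Q hQ => ⟨hQ.1, ErasedWord.exists_martinBoundary_of_ergodic hQ⟩
  · rintro Q ⟨hQ, μ, hμ, hm⟩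
    exact ErasedWord.mem_ergodicGEWPLaws_of_martinBoundary hQ hμ hm
  · intro μ hμ
    obtain ⟨w, hw⟩ := id hμ
    obtain ⟨Q, hQ, hm⟩ := hw.consistent.exists_gewpLaw
    exact ⟨Q, ErasedWord.mem_ergodicGEWPLaws_of_martinBoundary hQ hμ hm, hm⟩
  · rintro μ ⟨Q, hQ, hm⟩
    obtain ⟨μ', hμ', hm'⟩ := ErasedWord.exists_martinBoundary_of_ergodic hQ
    -- A law has only one sequence of marginals, so the boundary point found is the given one.
    have : μ = μ' := funext fun k => Subtype.ext ((hm k).symm.trans (hm' k))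
    rwa [this]
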